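/- **Theorem (complete intersection and freeness criterion).** *Setting.* Let $F$ be a global field. For a finite place $v$ of $F$ let $F_v$ be the completion, $k(v)$ the residue field and $q_v=\#k(v)$. Let $H$ be a torus over $F$ of dimension $d$. Let $\ell$ be a prime and $o_\lambda$ a complete noetherian local ring with maximal ideal $m_\lambda$ whose residue field $k_\lambda$ is finite of characteristic $\ell$. Let $X$ be a set of finite sets of finite places of $F$ with $\emptyset\in X$. Let $R$ be a complete noetherian local $o_\lambda$-algebra with residue field $k_\lambda$ and $M$ a finitely generated $R$-module. *Taylor–Wiles systems.* A Taylor–Wiles system $\{R_Q,M_Q\}_{Q\in X}$ for $(R,M)$ and $H$ consists of the following. * For all $Q\in X$ and $v\in Q$, the torus $H$ is split at $v$ and $q_v\equiv 1 \bmod \ell$. Let $\Delta_v$ be the $\ell$-Sylow subgroup of $H(k(v))$ (the $k(v)$-points of the split model of $H_{F_v}$ over the ring of integers of $F_v$), and let $\Delta_Q=\prod_{v\in Q}\Delta_v$. * For $Q\in X$, $R_Q$ is a complete noetherian local $o_\lambda[\Delta_Q]$-algebra with residue field $k_\lambda$, and $M_Q$ is an $R_Q$-module; for $Q=\emptyset$,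 $(R_\emptyset,M_\emptyset)=(R,M)$. * For $Q\in X$, a surjection $R_Q/I_QR_Q\twoheadrightarrow R$ of local $o_\lambda$-algebras, where $I_Q\subset o_\lambda[\Delta_Q]$ is the augmentation ideal; for $Q=\emptyset$ it is the identity of $R$. * For $Q\in X$, the homomorphism $R_Q/I_QR_Q\to \mathrm{End}_{o_\lambda}(M_Q/I_QM_Q)$ factors through $R$, and $M_Q/I_QM_Q$ is isomorphic to $M$ as an $R$-module. * There is an integer $\alpha\ge 1$ such that $M_Q$ is free of rank $\alpha$ over $o_\lambda[\Delta_Q]$ for every $Q\in X$. *Theorem.* Let $\{R_Q,M_Q\}_{Q\in X}$ be a Taylor–Wiles system for $(R,M)$ and $H$. Assume: 1. for every integer $n\ge 0$ the set $X_n=\{Q\in X : q_v\equiv 1 \bmod \ell^n \text{ for all } v\in Q\}$ is infinite; 2. $r=\#Q$ is the same for all $Q\in X$ with $Q\ne\emptyset$; 3. for every $Q\in X$, $R_Q$ is topologically generated as an $o_\lambda$-algebra by at most $dr$ elements (the $o_\lambda$-subalgebra they generate is dense for the topology defined by the maximal ideal of $R_Q$). Then: * $R$ is flat over $o_\lambda$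 and a relative complete intersection of relative dimension zero over $o_\lambda$; that is, $R$ is finite and flat over $o_\lambda$ and, for some $n$, $R\cong o_\lambda[[T_1,\dots,T_n]]/(f_1,\dots,f_n)$ where the images of $f_1,\dots,f_n$ in $k_\lambda[[T_1,\dots,T_n]]$ form a regular sequence; * $M$ is a free $R$-module; * the canonical map from $R$ onto its image in $\mathrm{End}_{o_\lambda}M$ is an isomorphism. -/

import Mathlib

open scoped TensorProduct

noncomputable section

/-- A global field: a number field, or a finite extension of `𝔽_p(X)` for some prime `p`. -/
def IsGlobalField (F : Type*) [Field F] : Prop :=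
  NumberField F ∨
    ∃ (p : ℕ) (_ : Fact p.Prime) (_ : Algebra (RatFunc (ZMod p)) F),
      FiniteDimensional (RatFunc (ZMod p)) F

/-- The finite (that is, non-archimedean) places of a global field `F`, given by their valuation
rings: the discrete valuation rings with fraction field `F`. -/
abbrev FinPlace (F : Type*) [Field F] : Type _ :=
  {v : ValuationSubring F // IsDiscreteValuationRing v}

namespace FinPlace

variable {F : Type*} [Field F] (v : FinPlace F)

instance : IsDiscreteValuationRing v.1 := v.2

/-- The residue field `k(v)`. -/
abbrev residueField : Type _ := IsLocalRing.ResidueField v.1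

/-- The cardinality `q_v` of the residue field `k(v)`. -/
def q : ℕ := Nat.card v.residueField

/-- The completion `F_v` of `F` at `v`. -/
abbrev completion : Type _ := (IsDiscreteValuationRing.maximalIdeal v.1).adicCompletion F

end FinPlace

/-- The affine group scheme `Spec A` over the field `K` is isomorphic to `𝔾_m ^ d`. -/
def IsSplitTorus (K A : Type*) [Field K] [CommRing A] [HopfAlgebra K A] (d : ℕ) : Prop :=
  Nonempty (A ≃ₐc[K] MonoidAlgebra K (Multiplicative (Fin d → ℤ)))

/-- The affine group scheme `Spec A` over the field `K` is a torus of dimension `d`: it becomes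
isomorphic to `𝔾_m ^ d` over a separable closure of `K`. -/
def IsTorus (K A : Type*) [Field K] [CommRing A] [HopfAlgebra K A] (d : ℕ) : Prop :=
  IsSplitTorus (SeparableClosure K) (SeparableClosure K ⊗[K] A) d

/-- The group of `k`-points of the diagonalizable group `Spec k[Y]` with character group `Y`:
the `k`-algebra homomorphisms `k[Y] → k`, with the convolution product. -/
def diagonalizablePoints (k Y : Type*) [Field k] [CommGroup Y] : Type _ :=
  WithConv (MonoidAlgebra k Y →ₐ[k] k)

instance (k Y : Type*) [Field k] [CommGroup Y] : CommGroup (diagonalizablePoints k Y) :=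
  inferInstanceAs (CommGroup (WithConv (MonoidAlgebra k Y →ₐ[k] k)))

section LocalTorus

variable {F : Type*} [Field F] (A : Type*) [CommRing A] [HopfAlgebra F A] (v : FinPlace F)

/-- The torus `H = Spec A` over `F`, of dimension `d`, is split at `v`. -/
def IsSplitAt (d : ℕ) : Prop :=
  IsSplitTorus v.completion (v.completion ⊗[F] A) d

/-- The group of characters of `H` defined over `F_v`, as the group of group-like elements of the
coordinate ring of `H` over `F_v`. -/
abbrev localCharacters : Type _ := GroupLike v.completion (v.completion ⊗[F] A)

/-- The group `H(k(v))` for a torus `H = Spec A` that is split at `v`. If `Y` is the character group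
of `H` over `F_v`, then `H` over `F_v` extends to the split torus `Spec o_{F_v}[Y]` over `o_{F_v}`;
its special fibre is `Spec k(v)[Y]`, and `H(k(v))` is the group of `k(v)`-points of this fibre. -/
abbrev residuePoints : Type _ := diagonalizablePoints v.residueField (localCharacters A v)

end LocalTorus

/-- The `ℓ`-Sylow subgroup of a commutative group: the elements of `ℓ`-power order. -/
def commSylow (ℓ : ℕ) [Fact ℓ.Prime] (G : Type*) [CommGroup G] : Sylow ℓ G where
  toSubgroup := CommGroup.primaryComponent G ℓ
  isPGroup' := CommGroup.primaryComponent.isPGroup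
  is_maximal' := by
    intro Q hQ hle
    refine le_antisymm (fun x hx => ?_) hle
    obtain ⟨n, hn⟩ := (IsPGroup.iff_orderOf.mp hQ) ⟨x, hx⟩
    rw [Subgroup.orderOf_mk] at hn
    exact ⟨n, hn ▸ pow_orderOf_eq_one x⟩

section Delta

variable {F : Type*} [Field F] (A : Type*) [CommRing A] [HopfAlgebra F A]
  (ℓ : ℕ) [Fact ℓ.Prime]

/-- `Δ_v`, the `ℓ`-Sylow subgroup of `H(k(v))`. -/
abbrev DeltaPlace (v : FinPlace F) : Type _ := commSylow ℓ (residuePoints A v)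

/-- `Δ_Q`, the product of the groups `Δ_v` for `v ∈ Q`. -/
abbrev DeltaSet (Q : Finset (FinPlace F)) : Type _ := (v : {v // v ∈ Q}) → DeltaPlace A ℓ v.1

end Delta

/-- The augmentation ideal of the group ring `o[G]`. -/
def augmentationIdeal (o G : Type*) [CommRing o] [CommGroup G] : Ideal (MonoidAlgebra o G) :=
  RingHom.ker (Bialgebra.counitAlgHom o (MonoidAlgebra o G))

/-- `R` is a complete noetherian local `o`-algebra with the same residue field as the local
ring `o`. -/
structure IsCompleteNoetherianLocalAlgebra (o R : Type*) [CommRing o] [IsLocalRing o]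
    [CommRing R] [Algebra o R] : Prop where
  isNoetherianRing : IsNoetherianRing R
  isLocalRing : IsLocalRing R
  isAdicComplete : IsAdicComplete (IsLocalRing.maximalIdeal R) R
  isLocalHom : IsLocalHom (algebraMap o R)
  residue_bijective : Function.Bijective (IsLocalRing.ResidueField.map (algebraMap o R))

/-- The local `o`-algebra `R` is topologically generated by at most `m` elements: for some finite
set of at most `m` elements, the `o`-subalgebra generated by it is dense for the topology defined
by the powers of the maximal ideal of `R`. -/
def IsTopologicallyGeneratedBy (o R : Type*) [CommRing o] [CommRing R] [IsLocalRing R]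
    [Algebra o R] (m : ℕ) : Prop :=
  ∃ s : Finset R, s.card ≤ m ∧
    ∀ (x : R) (n : ℕ), ∃ y ∈ Algebra.adjoin o (s : Set R),
      x - y ∈ IsLocalRing.maximalIdeal R ^ n

/-- A Taylor–Wiles system `{R_Q, M_Q}_{Q ∈ X}` for `(R, M)` and the torus `H = Spec A` of dimension
`d` over `F`, with coefficient ring `o` and residue characteristic `ℓ`. -/
structure TaylorWilesSystem (F : Type*) [Field F] (A : Type*) [CommRing A] [HopfAlgebra F A]
    (d ℓ : ℕ) [Fact ℓ.Prime] (o : Type*) [CommRing o] [IsLocalRing o]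
    (X : Set (Finset (FinPlace F)))
    (R : Type*) [CommRing R] [Algebra o R]
    (M : Type*) [AddCommGroup M] [Module R M] [Module o M] [IsScalarTower o R M] where
  empty_mem : ∅ ∈ X
  /- Conditions on the places occurring in `X`. -/
  isSplitAt : ∀ Q ∈ X, ∀ v ∈ Q, IsSplitAt A v d
  q_modEq_one : ∀ Q ∈ X, ∀ v ∈ Q, v.q ≡ 1 [MOD ℓ]
  /- The rings `R_Q`, as `o`-algebras and as `o[Δ_Q]`-algebras, and the modules `M_Q`.
  (As `Δ_Q` is an `ℓ`-group, `o[Δ_Q]` is local with residue field that of `o`,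
  and `o[Δ_Q] → R_Q` is a local homomorphism as soon as `o → R_Q` is one.) -/
  RQ : X → Type*
  [commRing : ∀ Q, CommRing (RQ Q)]
  [algebra : ∀ Q, Algebra o (RQ Q)]
  [algebraGroupRing : ∀ Q : X, Algebra (MonoidAlgebra o (DeltaSet A ℓ Q.1)) (RQ Q)]
  [isScalarTower : ∀ Q : X, IsScalarTower o (MonoidAlgebra o (DeltaSet A ℓ Q.1)) (RQ Q)]
  isCompleteNoetherianLocalAlgebra : ∀ Q, IsCompleteNoetherianLocalAlgebra o (RQ Q)
  MQ : X → Type*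
  [addCommGroup : ∀ Q, AddCommGroup (MQ Q)]
  [module : ∀ Q, Module (RQ Q) (MQ Q)]
  [moduleBase : ∀ Q, Module o (MQ Q)]
  [moduleGroupRing : ∀ Q : X, Module (MonoidAlgebra o (DeltaSet A ℓ Q.1)) (MQ Q)]
  [isScalarTowerBase : ∀ Q, IsScalarTower o (RQ Q) (MQ Q)]
  [isScalarTowerGroupRing :
    ∀ Q : X, IsScalarTower (MonoidAlgebra o (DeltaSet A ℓ Q.1)) (RQ Q) (MQ Q)]
  /- The surjection `R_Q / I_Q R_Q → R`; for `Q = ∅` (where `I_Q = 0`) it identifies `R_∅`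
  with `R`. -/
  toR : ∀ Q : X,
    (RQ Q ⧸ (augmentationIdeal o (DeltaSet A ℓ Q.1)).map
      (algebraMap (MonoidAlgebra o (DeltaSet A ℓ Q.1)) (RQ Q))) →ₐ[o] R
  toR_surjective : ∀ Q, Function.Surjective (toR Q)
  toR_empty_bijective : Function.Bijective (toR ⟨∅, empty_mem⟩)
  /- The action of `R_Q` on `M_Q / I_Q M_Q` factors through an action `ψ` of `R`, and for this
  action `M_Q / I_Q M_Q` is isomorphic to `M`. -/
  factors : ∀ Q : X,
    ∃ ψ : R →ₐ[o] Module.End o (MQ Q ⧸ ((augmentationIdeal o (DeltaSet A ℓ Q.1)).map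
        (algebraMap (MonoidAlgebra o (DeltaSet A ℓ Q.1)) (RQ Q)) •
          (⊤ : Submodule (RQ Q) (MQ Q)))),
      (∀ a : RQ Q, ψ (toR Q (Ideal.Quotient.mk _ a)) = Algebra.lsmul o o _ a) ∧
      ∃ e : (MQ Q ⧸ ((augmentationIdeal o (DeltaSet A ℓ Q.1)).map
        (algebraMap (MonoidAlgebra o (DeltaSet A ℓ Q.1)) (RQ Q)) •
          (⊤ : Submodule (RQ Q) (MQ Q)))) ≃ₗ[o] M,
        ∀ (a : R) (x), e (ψ a x) = a • e x
  /- `M_Q` is free over `o[Δ_Q]`, of a finite rank that does not depend on `Q`. -/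
  rank : ℕ
  one_le_rank : 1 ≤ rank
  free : ∀ Q : X, Module.Free (MonoidAlgebra o (DeltaSet A ℓ Q.1)) (MQ Q)
  finite : ∀ Q : X, Module.Finite (MonoidAlgebra o (DeltaSet A ℓ Q.1)) (MQ Q)
  finrank_eq : ∀ Q : X, Module.finrank (MonoidAlgebra o (DeltaSet A ℓ Q.1)) (MQ Q) = rank

attribute [instance] TaylorWilesSystem.commRing TaylorWilesSystem.algebra
  TaylorWilesSystem.algebraGroupRing TaylorWilesSystem.isScalarTower
  TaylorWilesSystem.addCommGroup TaylorWilesSystem.module TaylorWilesSystem.moduleBase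
  TaylorWilesSystem.moduleGroupRing TaylorWilesSystem.isScalarTowerBase
  TaylorWilesSystem.isScalarTowerGroupRing

instance TaylorWilesSystem.instIsLocalRing {F : Type*} [Field F] {A : Type*} [CommRing A]
    [HopfAlgebra F A] {d ℓ : ℕ} [Fact ℓ.Prime] {o : Type*} [CommRing o] [IsLocalRing o]
    {X : Set (Finset (FinPlace F))}
    {R : Type*} [CommRing R] [Algebra o R]
    {M : Type*} [AddCommGroup M] [Module R M] [Module o M] [IsScalarTower o R M]
    (T : TaylorWilesSystem F A d ℓ o X R M) (Q : X) : IsLocalRing (T.RQ Q) :=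
  (T.isCompleteNoetherianLocalAlgebra Q).isLocalRing

/-- The complete noetherian local `o`-algebra `R` (with the residue field `k` of `o`) is a relative
complete intersection of relative dimension zero over the complete noetherian local ring `o`:
it is finite and flat, and of the form `o[[T_1, …, T_n]] / (f_1, …, f_n)`, where the images of
`f_1, …, f_n` in `k[[T_1, …, T_n]]` form a regular sequence (so that the closed fibre is a complete
intersection of dimension zero, and `f_1, …, f_n` is itself a regular sequence). -/
structure IsRelativeCompleteIntersectionDimZero (o R : Type*) [CommRing o] [IsLocalRing o]
    [CommRing R] [Algebra o R] : Prop where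
  flat : Module.Flat o R
  finite : Module.Finite o R
  exists_presentation : ∃ (n : ℕ) (f : Fin n → MvPowerSeries (Fin n) o),
    Nonempty ((MvPowerSeries (Fin n) o ⧸ Ideal.span (Set.range f)) ≃ₐ[o] R) ∧
    RingTheory.Sequence.IsRegular (MvPowerSeries (Fin n) (IsLocalRing.ResidueField o))
      (List.ofFn fun i => MvPowerSeries.map (IsLocalRing.residue o) (f i))

end

open scoped TensorProduct

noncomputable section

/-! Put N = dr and let k be the residue field of o. For each n choose a nonempty Q ∈ X with q_v ≡ 1
mod ℓ^(n+1) for v ∈ Q. Then Δ_Q has elements δ_1, …, δ_N that some homomorphism sends to the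
standard generators of (ℤ/ℓ^(n+1))^N, so there is a map from o[Δ_Q] to k⟦S_1, …, S_N⟧ modulo order n
+ 1 with δ_j ↦ 1 + S_j. As R_Q is a quotient of o⟦T_1, …, T_N⟧ and M_Q is free of rank α over
o[Δ_Q], base change turns M_Q into a representation of k⟦T⟧ by α × α matrices over k⟦S⟧ modulo order
n + 1, in which S_i is the action of some f_{n,i} ∈ k⟦T⟧. Everything rests on there being as many
variables S as T.

The levels are unrelated to each other, but k is finite, so a limit along a nonprincipal ultrafilter
exists coefficient by coefficient (`exists_ultrafilter_limit_hom`). It makes k⟦S⟧^α a k⟦T⟧-module on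
which the limit g_i of the f_{n,i} acts as S_i. This module is finite, and g_1, …, g_N is weakly
regular on it with N = dim k⟦T⟧, so it is free by the Auslander–Buchsbaum count of projective
dimension (`free_matrixModule`). Hence g is a regular sequence in k⟦T⟧ and k^α = k⟦S⟧^α/(S) is free
over k⟦T⟧/(g).

For almost all n along the ultrafilter, this k^α is M/m_o M with its action of o⟦T⟧ through R, and
g_i lies in (f_{n,1}, …, f_{n,N}), so it lifts to some G_i that vanishes in R
(`exists_free_residual_of_matrix_system`). Since M is free over o, Nakayama lifts the residual
statement to o⟦T⟧^s/(G) ≅ M with s ≥ 1 (`completeIntersection_and_free_of_residual`). This gives R =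
o⟦T⟧/(G), M ≅ R^s, and R as an o-direct summand of M, so R is finite and flat over o and acts
faithfully on M. -/

namespace MvPowerSeries

/-! ### Power series filtered by order -/

section Order

variable {σ R : Type*} [CommRing R]

/-- The ideal of power series of order at least `a`. -/
def orderIdeal (σ R : Type*) [CommRing R] (a : ℕ) : Ideal (MvPowerSeries σ R) where
  carrier := {p | (a : ℕ∞) ≤ p.order}
  zero_mem' := by simp
  add_mem' {p q} hp hq := (le_min hp hq).trans min_order_le_add
  smul_mem' p q hq := (le_add_left hq).trans le_order_mul

theorem mem_orderIdeal {a : ℕ} {p : MvPowerSeries σ R} :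
    p ∈ orderIdeal σ R a ↔ ∀ d : σ →₀ ℕ, d.degree < a → coeff d p = 0 :=
  ⟨fun h _ hd => coeff_of_lt_order ((Nat.cast_lt.mpr hd).trans_le h), fun h => nat_le_order h⟩

theorem mem_orderIdeal_one {p : MvPowerSeries σ R} :
    p ∈ orderIdeal σ R 1 ↔ constantCoeff p = 0 := by
  rw [← one_le_order_iff_constCoeff_eq_zero]
  exact Iff.rfl

theorem orderIdeal_anti {a b : ℕ} (h : a ≤ b) : orderIdeal σ R b ≤ orderIdeal σ R a :=
  fun _ hp => (Nat.cast_le.mpr h : (a : ℕ∞) ≤ b).trans hp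

theorem mul_mem_orderIdeal {a b : ℕ} {p q : MvPowerSeries σ R} (hp : p ∈ orderIdeal σ R a)
    (hq : q ∈ orderIdeal σ R b) : p * q ∈ orderIdeal σ R (a + b) := by
  refine le_trans ?_ le_order_mul
  push_cast
  exact add_le_add hp hq

theorem X_mem_orderIdeal (j : σ) : (X j : MvPowerSeries σ R) ∈ orderIdeal σ R 1 :=
  mem_orderIdeal_one.mpr (constantCoeff_X j)

theorem X_pow_mem_orderIdeal (j : σ) (a : ℕ) :
    (X j : MvPowerSeries σ R) ^ a ∈ orderIdeal σ R a := by
  induction a with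
  | zero => exact mem_orderIdeal.mpr fun d hd => absurd hd (Nat.not_lt_zero _)
  | succ a ih =>
    rw [pow_succ]
    exact mul_mem_orderIdeal ih (X_mem_orderIdeal j)

theorem eq_zero_of_forall_mem_orderIdeal {p : MvPowerSeries σ R}
    (h : ∀ a, p ∈ orderIdeal σ R a) : p = 0 := by
  ext d
  exact mem_orderIdeal.mp (h (d.degree + 1)) d (Nat.lt_succ_self _)

/-- Induction on s: the terms divisible by X_j^b are split off by shifting coefficients, and the
remainder involves only the other variables' powers. No hypothesis on R is needed. -/
theorem mem_span_X_pow {s : Finset σ} {b : ℕ} {p : MvPowerSeries σ R} :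
    p ∈ Ideal.span ((fun j => (X j : MvPowerSeries σ R) ^ b) '' s) ↔
      ∀ d : σ →₀ ℕ, (∀ j ∈ s, d j < b) → coeff d p = 0 := by
  classical
  constructor
  · intro h
    induction h using Submodule.span_induction with
    | mem x hx =>
      obtain ⟨j, hj, rfl⟩ := hx
      intro d hd
      simp only [coeff_X_pow]
      rw [if_neg]
      rintro rfl
      simpa using hd j hj
    | zero => simp
    | add x y _ _ hx hy => intro d hd; rw [map_add, hx d hd, hy d hd, add_zero]
    | smul a x _ hx =>
      intro d hd
      rw [smul_eq_mul, coeff_mul]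
      refine Finset.sum_eq_zero fun uv huv => ?_
      rw [hx uv.2, mul_zero]
      intro j hj
      refine lt_of_le_of_lt ?_ (hd j hj)
      rw [← Finset.HasAntidiagonal.mem_antidiagonal.mp huv]
      simp
  · induction s using Finset.induction_on generalizing p with
    | empty =>
      intro h
      have : p = 0 := by ext d; exact h d (by simp)
      simp [this]
    | insert j s hj ih =>
      intro h
      let r : MvPowerSeries σ R := fun d => coeff (d + Finsupp.single j b) p
      have hr (d) : coeff d r = coeff (d + Finsupp.single j b) p := rfl
      have hq : p - r * X j ^ b ∈ Ideal.span ((fun j => (X j : MvPowerSeries σ R) ^ b) '' s) := by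
        refine ih fun d hd => ?_
        rw [map_sub, X_pow_eq, coeff_mul_monomial, mul_one]
        split_ifs with hjd
        · rw [hr, tsub_add_cancel_of_le hjd, sub_self]
        · rw [sub_zero]
          refine h d fun i hi => ?_
          rcases Finset.mem_insert.mp hi with rfl | hi
          · by_contra hb
            exact hjd (Finsupp.single_le_iff.mpr (not_lt.mp hb))
          · exact hd i hi
      rw [← sub_add_cancel p (r * X j ^ b)]
      refine add_mem (Ideal.span_mono (Set.image_mono (by simp)) hq)
        (Ideal.mul_mem_left _ _ (Ideal.subset_span ⟨j, by simp, rfl⟩))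

/-- A monomial with all N exponents below b has degree at most N * b. -/
theorem orderIdeal_le_span_X_pow (N b : ℕ) :
    orderIdeal (Fin N) R (N * b + 1) ≤
      Ideal.span (Set.range fun j => (X j : MvPowerSeries (Fin N) R) ^ b) := by
  intro p hp
  have h := (mem_span_X_pow (s := Finset.univ) (b := b) (p := p)).mpr fun d hd => by
    refine mem_orderIdeal.mp hp d (Nat.lt_succ_of_le ?_)
    rw [Finsupp.degree_eq_sum]
    exact (Finset.sum_le_card_nsmul _ _ b fun j hj => (hd j hj).le).trans (by simp)
  simpa using h

theorem orderIdeal_one_eq_span (N : ℕ) :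
    orderIdeal (Fin N) R 1 = Ideal.span (Set.range (X : Fin N → MvPowerSeries (Fin N) R)) := by
  refine le_antisymm (fun p hp => ?_) (Ideal.span_le.mpr ?_)
  · have h := (mem_span_X_pow (s := Finset.univ) (b := 1) (p := p)).mpr fun d hd => by
      refine mem_orderIdeal.mp hp d ?_
      have : d = 0 := by ext j; simpa using hd j (Finset.mem_univ j)
      simp [this]
    simpa using h
  · rintro _ ⟨j, rfl⟩
    exact X_mem_orderIdeal j

theorem isWeaklyRegular_X (N : ℕ) :
    RingTheory.Sequence.IsWeaklyRegular (MvPowerSeries (Fin N) R)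
      (List.ofFn (X : Fin N → MvPowerSeries (Fin N) R)) := by
  classical
  refine (RingTheory.Sequence.isWeaklyRegular_iff_Fin _ _).mpr fun i => ?_
  have hi : (i : ℕ) < N := by simpa using i.2
  have key : Ideal.ofList ((List.ofFn (X : Fin N → MvPowerSeries (Fin N) R)).take i) • ⊤ =
      Ideal.span ((fun j => (X j : MvPowerSeries (Fin N) R) ^ 1) ''
        (Finset.univ.filter fun j : Fin N => (j : ℕ) < i : Finset (Fin N))) := by
    rw [smul_eq_mul, Ideal.mul_top, Ideal.ofList]
    congr 1
    ext x
    simp only [Set.mem_ofPred_eq, List.mem_take_iff_getElem, pow_one, Set.mem_image,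
      Finset.coe_filter, Finset.mem_univ, true_and]
    constructor
    · rintro ⟨j, hj, rfl⟩
      exact ⟨⟨j, by simpa using (lt_min_iff.mp hj).2⟩, (lt_min_iff.mp hj).1, by simp⟩
    · rintro ⟨j, hj, rfl⟩
      exact ⟨j, lt_min hj (by simp), by simp⟩
  rw [key, isSMulRegular_iff_right_eq_zero_of_smul]
  intro x
  obtain ⟨p, rfl⟩ := Ideal.Quotient.mk_surjective x
  intro h
  have h' : (X ⟨i, hi⟩ : MvPowerSeries (Fin N) R) * p ∈ Ideal.span ((fun j =>
      (X j : MvPowerSeries (Fin N) R) ^ 1) ''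
        (Finset.univ.filter fun j : Fin N => (j : ℕ) < i : Finset (Fin N))) := by
    rw [← Ideal.Quotient.eq_zero_iff_mem, ← h, ← smul_eq_mul]
    simp
    rfl
  refine Ideal.Quotient.eq_zero_iff_mem.mpr (mem_span_X_pow.mpr fun d hd => ?_)
  have := mem_span_X_pow.mp h' (Finsupp.single ⟨i, hi⟩ 1 + d) fun j hj => by
    have hne : (⟨i, hi⟩ : Fin N) ≠ j := by
      rintro rfl
      simp at hj
    simpa [Finsupp.single_apply, hne] using hd j hj
  simpa [X, coeff_add_monomial_mul] using this

end Order

/-- Finite generation of the kernel lets the infinitely many coefficients be written in the same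
generators, whose multipliers then assemble into finitely many power series. -/
theorem ker_map_le_map_C {σ R S : Type*} [CommRing R] [CommRing S] (f : R →+* S)
    (hf : (RingHom.ker f).FG) :
    RingHom.ker (map (σ := σ) f) ≤ (RingHom.ker f).map (C : R →+* MvPowerSeries σ R) := by
  obtain ⟨n, x, hx⟩ := Submodule.fg_iff_exists_fin_generating_family.mp hf
  intro p hp
  have hc (d : σ →₀ ℕ) : ∃ c : Fin n → R, ∑ i, c i • x i = coeff d p := by
    rw [← Submodule.mem_span_range_iff_exists_fun, hx, RingHom.mem_ker, ← coeff_map,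
      RingHom.mem_ker.mp hp, map_zero]
  choose c hc using hc
  let q (i : Fin n) : MvPowerSeries σ R := fun d => c d i
  have : p = ∑ i, q i * C (x i) := by
    ext d
    rw [map_sum, ← hc d]
    exact Finset.sum_congr rfl fun i _ => by rw [coeff_mul_C, smul_eq_mul]; rfl
  rw [this]
  refine sum_mem fun i _ => Ideal.mul_mem_left _ _ (Ideal.mem_map_of_mem _ ?_)
  rw [← hx]
  exact Submodule.subset_span ⟨i, rfl⟩

theorem map_surjective' {σ R S : Type*} [CommRing R] [CommRing S] {f : R →+* S}
    (hf : Function.Surjective f) : Function.Surjective (map (σ := σ) f) := by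
  intro p
  choose g hg using hf
  let q : MvPowerSeries σ R := fun d => g (coeff d p)
  refine ⟨q, ?_⟩
  ext d
  rw [coeff_map]
  exact hg _

end MvPowerSeries

theorem RingTheory.Sequence.IsWeaklyRegular.pi {R : Type*} [CommRing R] {rs : List R}
    (h : IsWeaklyRegular R rs) (ι : Type*) [Finite ι] : IsWeaklyRegular (ι → R) rs :=
  ((TensorProduct.rid R (ι → R)).isWeaklyRegular_congr rs).mp
    (h.isWeaklyRegular_lTensor (M₂ := ι → R))

/-! ### Freeness through projective dimension -/

section ProjectiveDimension

universe u

open CategoryTheory IsLocalRing RingTheory.Sequence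

variable {A : Type u} [CommRing A] [IsLocalRing A]

/-- Dévissage: every simple module over a local ring is the residue field, and the bound passes to
extensions. -/
theorem hasProjectiveDimensionLT_of_isFiniteLength (n : ℕ)
    (hk : HasProjectiveDimensionLT (ModuleCat.of A (A ⧸ maximalIdeal A)) n)
    {W : Type u} [AddCommGroup W] [Module A W] (hW : IsFiniteLength A W) :
    HasProjectiveDimensionLT (ModuleCat.of A W) n := by
  induction hW with
  | @of_subsingleton W _ _ _ =>
    have := (ModuleCat.isZero_of_subsingleton (ModuleCat.of A W)).hasProjectiveDimensionLT_zero
    exact hasProjectiveDimensionLT_of_ge _ 0 n (Nat.zero_le n)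
  | @of_simple_quotient W _ _ V hs _ ih =>
    obtain ⟨I, hI, ⟨e⟩⟩ := isSimpleModule_iff_quot_maximal.mp hs
    obtain rfl := eq_maximalIdeal hI
    have hS := LinearMap.shortExact_shortComplexKer (f := V.mkQ) V.mkQ_surjective
    refine hS.hasProjectiveDimensionLT_X₂ n ?_ ?_
    · have e' : LinearMap.ker V.mkQ ≃ₗ[A] V := LinearEquiv.ofEq _ _ V.ker_mkQ
      exact hasProjectiveDimensionLT_of_iso e'.symm.toModuleIso n
    · exact hasProjectiveDimensionLT_of_iso e.symm.toModuleIso n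

/-- With m = `xs.length`, the residue field has projective dimension m, so the finite length module
M/(fs)M has projective dimension at most m. Dividing by the m elements of `fs` raises the projective
dimension of M by exactly m, so M is projective. -/
theorem Module.free_of_isWeaklyRegular [IsNoetherianRing A] {xs : List A} (hxs : IsRegular A xs)
    (hmax : Ideal.ofList xs = maximalIdeal A) {M : Type u} [AddCommGroup M] [Module A M]
    [Module.Finite A M] {fs : List A} (hlen : fs.length = xs.length)
    (hmem : ∀ f ∈ fs, f ∈ maximalIdeal A) (hfs : IsWeaklyRegular M fs)
    (hfin : IsFiniteLength A (M ⧸ (Ideal.ofList fs • ⊤ : Submodule A M))) :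
    Module.Free A M := by
  rcases subsingleton_or_nontrivial M with hM | hM
  · infer_instance
  have hk : HasProjectiveDimensionLT (ModuleCat.of A (A ⧸ maximalIdeal A)) (xs.length + 1) := by
    rw [← projectiveDimension_lt_iff, ← hmax]
    have h := ModuleCat.projectiveDimension_quotient_eq_length.{u} xs hxs
    rw [projectiveDimension_eq_of_iso (Shrink.linearEquiv A (A ⧸ Ideal.ofList xs)).toModuleIso] at h
    rw [h]
    exact_mod_cast Nat.lt_succ_self _
  have h1 := hasProjectiveDimensionLT_of_isFiniteLength _ hk hfin
  have h2 := ModuleCat.projectiveDimension_quotient_eq_add_length_of_isWeaklyRegular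
    (ModuleCat.of A M) fs hfs hmem
  have h3 : projectiveDimension (ModuleCat.of A M) ≤ 0 := by
    have h4 : projectiveDimension (ModuleCat.of A M) + xs.length ≤ (xs.length : ℕ) := by
      rw [← hlen, ← h2, projectiveDimension_le_iff, hlen]
      exact h1
    refine (ENat.WithBot.add_le_add_natCast_right_iff (c := xs.length)).mp ?_
    rwa [zero_add]
  have h5 : HasProjectiveDimensionLE (ModuleCat.of A M) 0 :=
    (projectiveDimension_le_iff _ 0).mp (by simpa using h3)
  rw [← projective_iff_hasProjectiveDimensionLE_zero, ← IsProjective.iff_projective] at h5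
  exact Module.free_of_flat_of_isLocalRing

end ProjectiveDimension

/-! ### The regular local ring K⟦X₁, …, X_N⟧ -/

namespace MvPowerSeries

open IsLocalRing RingTheory.Sequence

variable {K : Type*} [Field K] {N : ℕ}

theorem mem_maximalIdeal_iff {p : MvPowerSeries (Fin N) K} :
    p ∈ maximalIdeal (MvPowerSeries (Fin N) K) ↔ p ∈ orderIdeal (Fin N) K 1 := by
  rw [mem_maximalIdeal, mem_nonunits_iff, isUnit_iff_constantCoeff, isUnit_iff_ne_zero, not_not,
    mem_orderIdeal_one]

theorem ofList_X_eq_maximalIdeal :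
    Ideal.ofList (List.ofFn (X : Fin N → MvPowerSeries (Fin N) K)) =
      maximalIdeal (MvPowerSeries (Fin N) K) := by
  have h : Ideal.ofList (List.ofFn (X : Fin N → MvPowerSeries (Fin N) K)) =
      Ideal.span (Set.range X) := by
    rw [Ideal.ofList]
    congr 1
    ext x
    simp [List.mem_ofFn]
  rw [h, ← orderIdeal_one_eq_span]
  ext p
  exact mem_maximalIdeal_iff.symm

theorem isRegular_X :
    IsRegular (MvPowerSeries (Fin N) K) (List.ofFn (X : Fin N → MvPowerSeries (Fin N) K)) := by
  refine (isRegular_iff_isWeaklyRegular_of_subset_maximalIdeal fun r hr => ?_).mpr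
    (isWeaklyRegular_X N)
  rw [← ofList_X_eq_maximalIdeal]
  exact Ideal.subset_span hr

end MvPowerSeries

theorem mem_ideal_smul_top_pi {R ι : Type*} [CommRing R] [Finite ι] {I : Ideal R} {v : ι → R} :
    v ∈ (I • ⊤ : Submodule R (ι → R)) ↔ ∀ i, v i ∈ I := by
  classical
  have := Fintype.ofFinite ι
  constructor
  · intro h i
    have := Submodule.smul_top_le_comap_smul_top I (LinearMap.proj (R := R) (φ := fun _ => R) i) h
    simpa using this
  · intro h
    rw [pi_eq_sum_univ' v]
    exact sum_mem fun i _ => Submodule.smul_mem_smul (h i) trivial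

theorem IsPrecomplete.pi {R : Type*} [CommRing R] (I : Ideal R) [IsPrecomplete I R] (ι : Type*)
    [Finite ι] : IsPrecomplete I (ι → R) := by
  have key {n : ℕ} {x y : ι → R} : x ≡ y [SMOD (I ^ n • ⊤ : Submodule R (ι → R))] ↔
      ∀ i, x i ≡ y i [SMOD (I ^ n • ⊤ : Ideal R)] := by
    simp only [SModEq.sub_mem, mem_ideal_smul_top_pi, smul_eq_mul, Ideal.mul_top, Pi.sub_apply]
  refine ⟨fun f hf => ?_⟩
  have h (i : ι) := IsPrecomplete.prec (I := I) (M := R) inferInstance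
    (f := fun n => f n i) fun hmn => key.mp (hf hmn) i
  choose L hL using h
  exact ⟨L, fun n => key.mpr fun i => hL i n⟩

theorem Ultrafilter.exists_eventually_eq {α κ : Type*} [Finite κ] (U : Ultrafilter α) (u : α → κ) :
    ∃ c, ∀ᶠ n in U, u n = c := by
  obtain ⟨c, hc⟩ := (U.map u).eq_pure_of_finite
  exact ⟨c, show {c} ∈ U.map u by rw [hc]; exact Set.mem_singleton c⟩

/-! ### Ultrafilter limits and automatic continuity over a finite field -/

namespace MvPowerSeries

variable {K : Type*} [Field K] {N : ℕ}

/-- Each coefficient takes values in the finite set K, so it is constant on a set of U; an order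
condition involves only finitely many coefficients. -/
theorem exists_ultrafilter_limit [Finite K] {α : Type*} (U : Ultrafilter α)
    (u : α → MvPowerSeries (Fin N) K) :
    ∃ p, ∀ a, ∀ᶠ n in U, u n - p ∈ orderIdeal (Fin N) K a := by
  have h (d : Fin N →₀ ℕ) := U.exists_eventually_eq fun n => coeff d (u n)
  choose p hp using h
  let q : MvPowerSeries (Fin N) K := p
  refine ⟨q, fun a => ?_⟩
  have := (Filter.eventually_all_finite (Finsupp.finite_of_degree_lt (σ := Fin N) a)).mpr
    fun d _ => hp d
  filter_upwards [this] with n hn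
  refine mem_orderIdeal.mpr fun d hd => ?_
  rw [map_sub, hn d hd, sub_eq_zero]
  rfl

instance finite_quotient_orderIdeal [Finite K] (a : ℕ) :
    Finite (MvPowerSeries (Fin N) K ⧸ orderIdeal (Fin N) K a) := by
  have := (Finsupp.finite_of_degree_lt (σ := Fin N) a).to_subtype
  refine Finite.of_injective
    (fun x (d : {d : Fin N →₀ ℕ | d.degree < a}) => coeff d.1 (Quotient.out x)) fun x y hxy => ?_
  rw [← Ideal.Quotient.mk_out x, ← Ideal.Quotient.mk_out y, Ideal.Quotient.mk_eq_mk_iff_sub_mem,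
    mem_orderIdeal]
  intro d hd
  rw [map_sub, sub_eq_zero]
  exact congrFun hxy ⟨d, hd⟩

/-- Reduction of a matrix of power series modulo the series of order at least `a`. -/
abbrev reduceMatrix (ι : Type*) [Fintype ι] [DecidableEq ι] (N : ℕ) (K : Type*) [Field K] (a : ℕ) :
    Matrix ι ι (MvPowerSeries (Fin N) K) →+*
      Matrix ι ι (MvPowerSeries (Fin N) K ⧸ orderIdeal (Fin N) K a) :=
  (Ideal.Quotient.mk (orderIdeal (Fin N) K a)).mapMatrix

variable {ι : Type*} [Fintype ι] [DecidableEq ι]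

theorem reduceMatrix_eq_iff {a : ℕ} {E E' : Matrix ι ι (MvPowerSeries (Fin N) K)} :
    reduceMatrix ι N K a E = reduceMatrix ι N K a E' ↔
      ∀ i j, E i j - E' i j ∈ orderIdeal (Fin N) K a := by
  rw [← Matrix.ext_iff]
  exact forall₂_congr fun i j => Ideal.Quotient.mk_eq_mk_iff_sub_mem _ _

theorem eq_of_forall_reduceMatrix_eq {E E' : Matrix ι ι (MvPowerSeries (Fin N) K)}
    (h : ∀ a, reduceMatrix ι N K a E = reduceMatrix ι N K a E') : E = E' := by
  ext1 i j
  exact sub_eq_zero.mp (eq_zero_of_forall_mem_orderIdeal fun a => reduceMatrix_eq_iff.mp (h a) i j)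

/-- By pigeonhole two powers of f x coincide, with exponents a < b ≤ card T, and 1 - x^(b - a) is a
unit of A. -/
theorem pow_eq_zero_of_mem_maximalIdeal {A T : Type*} [CommRing A] [IsLocalRing A] [Ring T]
    [Finite T] (f : A →+* T) {x : A} (hx : x ∈ IsLocalRing.maximalIdeal A) :
    f x ^ Nat.card T = 0 := by
  have : Fintype T := Fintype.ofFinite T
  obtain ⟨a, b, hab, h⟩ := Fintype.exists_ne_map_eq_of_card_lt
    (fun m : Fin (Nat.card T + 1) => (f x) ^ (m : ℕ)) (by simp)
  wlog hlt : a < b generalizing a b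
  · exact this b a hab.symm h.symm (lt_of_le_of_ne (not_lt.mp hlt) hab.symm)
  have hlt' : (a : ℕ) < b := hlt
  have hu : IsUnit (1 - x ^ (b - a : ℕ)) :=
    IsLocalRing.isUnit_one_sub_self_of_mem_nonunits _
      ((IsLocalRing.mem_maximalIdeal _).mp (Ideal.pow_mem_of_mem _ hx _ (by omega)))
  have h0 : f x ^ (a : ℕ) = 0 := by
    refine (hu.map f).mul_left_eq_zero.mp ?_
    rw [map_sub, map_one, map_pow, mul_sub, mul_one, ← pow_add, Nat.add_sub_of_le hlt'.le]
    exact sub_eq_zero.mpr h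
  exact pow_eq_zero_of_le (Nat.lt_succ_iff.mp a.2) h0

theorem matrix_pow_eq_reduceMatrix {a : ℕ}
    {E : Matrix ι ι (MvPowerSeries (Fin N) K ⧸ orderIdeal (Fin N) K a)}
    {E' : Matrix ι ι (MvPowerSeries (Fin N) K)} (hE : reduceMatrix ι N K a E' = E)
    (h : ∀ i j, E' i j ∈ orderIdeal (Fin N) K 1) : E ^ a = 0 := by
  have key (b : ℕ) : ∀ i j, (E' ^ b) i j ∈ orderIdeal (Fin N) K b := by
    induction b with
    | zero => exact fun i j => mem_orderIdeal.mpr fun d hd => absurd hd (Nat.not_lt_zero _)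
    | succ b ih =>
      intro i j
      rw [pow_succ, Matrix.mul_apply]
      exact sum_mem fun l _ => mul_mem_orderIdeal (ih i l) (h l j)
  rw [← hE, ← map_pow, ← map_zero (reduceMatrix ι N K a), reduceMatrix_eq_iff]
  simpa using key a

/-- The order from which on all power series act as zero in every matrix representation of
size `ι` with entries modulo order `a`. -/
def vanishingOrder (ι : Type*) (N : ℕ) (K : Type*) [Field K] (a : ℕ) : ℕ :=
  N * (Nat.card (Matrix ι ι (MvPowerSeries (Fin N) K ⧸ orderIdeal (Fin N) K 1)) * a) + 1

/-- Automatic continuity: no topological condition is put on `f`, and the bound does not depend on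
`f`. This uniformity is what allows limits of unrelated representations. -/
theorem map_eq_zero_of_mem_orderIdeal [Finite K] {a : ℕ}
    (f : MvPowerSeries (Fin N) K →+*
      Matrix ι ι (MvPowerSeries (Fin N) K ⧸ orderIdeal (Fin N) K a))
    {x : MvPowerSeries (Fin N) K} (hx : x ∈ orderIdeal (Fin N) K (vanishingOrder ι N K a)) :
    f x = 0 := by
  rcases Nat.eq_zero_or_pos a with rfl | ha
  · have : Subsingleton (MvPowerSeries (Fin N) K ⧸ orderIdeal (Fin N) K 0) :=
      Ideal.Quotient.subsingleton_iff.mpr ((Ideal.eq_top_iff_one _).mpr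
        (mem_orderIdeal.mpr fun d hd => absurd hd (Nat.not_lt_zero _)))
    exact Subsingleton.elim _ _
  set c := Nat.card (Matrix ι ι (MvPowerSeries (Fin N) K ⧸ orderIdeal (Fin N) K 1)) with hc
  -- Modulo order 1 the target is a finite ring with c elements, where the c-th power of the image
  -- of X_j vanishes; so that power has entries of order at least 1, and its a-th power is zero
  -- modulo order a.
  have hX (j : Fin N) : f (X j) ^ (c * a) = 0 := by
    have h1 := pow_eq_zero_of_mem_maximalIdeal
      ((Ideal.Quotient.factor (orderIdeal_anti ha)).mapMatrix.comp f)
      (mem_maximalIdeal_iff.mpr (X_mem_orderIdeal j))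
    rw [← hc] at h1
    let E' : Matrix ι ι (MvPowerSeries (Fin N) K) := fun i l => Quotient.out ((f (X j) ^ c) i l)
    have hE' : reduceMatrix ι N K a E' = f (X j) ^ c := by
      ext1 i l
      exact Ideal.Quotient.mk_out _
    rw [pow_mul]
    refine matrix_pow_eq_reduceMatrix hE' fun i l => ?_
    have h2 : (Ideal.Quotient.factor (orderIdeal_anti ha)).mapMatrix (f (X j) ^ c) = 0 := by
      rw [map_pow]; exact h1
    rw [← hE'] at h2
    have h3 := congrFun₂ h2 i l
    exact Ideal.Quotient.eq_zero_iff_mem.mp h3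
  have h := orderIdeal_le_span_X_pow N (c * a) hx
  have hle : Ideal.span (Set.range fun j => (X j : MvPowerSeries (Fin N) K) ^ (c * a)) ≤
      RingHom.ker f := by
    rw [Ideal.span_le]
    rintro _ ⟨j, rfl⟩
    exact (map_pow f _ _).trans (hX j)
  exact hle h

end MvPowerSeries

/-- The module `ι → B` on which `A` acts through a ring homomorphism to matrices over `B`. -/
def MatrixModule {A B ι : Type*} [CommRing A] [CommRing B] [Fintype ι] [DecidableEq ι]
    (_ : A →+* Matrix ι ι B) : Type _ := ι → B

namespace MatrixModule

variable {A B ι : Type*} [CommRing A] [CommRing B] [Fintype ι] [DecidableEq ι]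
  (f : A →+* Matrix ι ι B)

instance : AddCommGroup (MatrixModule f) := inferInstanceAs (AddCommGroup (ι → B))

instance : Module A (MatrixModule f) :=
  Module.compHom (R := Module.End B (ι → B)) (ι → B)
    ((Matrix.toLinAlgEquiv' (R := B) (n := ι)).toRingEquiv.toRingHom.comp f)

/-- The underlying family of elements of `B`. -/
def equiv : MatrixModule f ≃+ (ι → B) := AddEquiv.refl _

theorem equiv_smul (a : A) (v : MatrixModule f) :
    equiv f (a • v) = Matrix.mulVec (f a) (equiv f v) := rfl

end MatrixModule

namespace MvPowerSeries

open IsLocalRing RingTheory.Sequence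

variable {K : Type*} [Field K] {N : ℕ} {ι : Type*} [Fintype ι] [DecidableEq ι]

/-! ### Freeness of the limit module -/

section Free

variable (φ : MvPowerSeries (Fin N) K →+* Matrix ι ι (MvPowerSeries (Fin N) K))
  (f : Fin N → MvPowerSeries (Fin N) K)

theorem matrixModule_smul_eq_of_scalar {x y : MvPowerSeries (Fin N) K}
    (h : φ x = Matrix.scalar ι y) (v : MatrixModule φ) :
    MatrixModule.equiv φ (x • v) = y • MatrixModule.equiv φ v := by
  rw [MatrixModule.equiv_smul, h, Matrix.scalar_apply, ← Matrix.smul_one_eq_diagonal,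
    Matrix.smul_mulVec, Matrix.one_mulVec]

variable {φ f}

/-- Since f i acts as X_i, dividing by the ideal of the f i amounts to taking constant coefficients,
with quotient K^ι. -/
theorem mem_span_smul_top_iff (hX : ∀ i, φ (f i) = Matrix.scalar ι (X i)) {v : MatrixModule φ} :
    v ∈ (Ideal.span (Set.range f) • ⊤ : Submodule (MvPowerSeries (Fin N) K) (MatrixModule φ)) ↔
      ∀ i, constantCoeff (MatrixModule.equiv φ v i) = 0 := by
  constructor
  · intro h
    induction h using Submodule.smul_induction_on' with
    | smul x hx w _ =>
      obtain ⟨c, rfl⟩ := (Ideal.mem_span_range_iff_exists_fun).mp hx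
      intro i
      rw [Finset.sum_smul, map_sum, Finset.sum_apply, map_sum]
      refine Finset.sum_eq_zero fun j _ => ?_
      rw [mul_comm, mul_smul, matrixModule_smul_eq_of_scalar φ (hX j), Pi.smul_apply, smul_eq_mul,
        map_mul, constantCoeff_X, zero_mul]
    | add x _ y _ hx hy =>
      intro i
      rw [map_add, Pi.add_apply, map_add, hx, hy, add_zero]
  · intro h
    have h' (i : ι) : ∃ c : Fin N → MvPowerSeries (Fin N) K, ∑ j, c j * X j =
        MatrixModule.equiv φ v i := by
      rw [← Ideal.mem_span_range_iff_exists_fun, ← orderIdeal_one_eq_span]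
      exact mem_orderIdeal_one.mpr (h i)
    choose c hc using h'
    have : v = ∑ j, f j • (MatrixModule.equiv φ).symm (fun i => c i j) := by
      refine (MatrixModule.equiv φ).injective (funext fun i => ?_)
      rw [map_sum, Finset.sum_apply, ← hc i]
      refine Finset.sum_congr rfl fun j _ => ?_
      rw [matrixModule_smul_eq_of_scalar φ (hX j), AddEquiv.apply_symm_apply, Pi.smul_apply,
        smul_eq_mul, mul_comm]
    rw [this]
    exact sum_mem fun j _ => Submodule.smul_mem_smul (Ideal.subset_span ⟨j, rfl⟩) trivial

theorem isHausdorff_matrixModule [Finite K] : IsHausdorff (orderIdeal (Fin N) K 1)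
    (MatrixModule φ) := by
  have hpow (b : ℕ) : orderIdeal (Fin N) K 1 ^ b ≤ orderIdeal (Fin N) K b := by
    induction b with
    | zero => exact fun p _ => mem_orderIdeal.mpr fun d hd => absurd hd (Nat.not_lt_zero _)
    | succ b ih =>
      rw [pow_succ]
      exact Ideal.mul_le.mpr fun p hp q hq => mul_mem_orderIdeal (ih hp) hq
  refine ⟨fun v hv => (MatrixModule.equiv φ).injective (funext fun i =>
    eq_zero_of_forall_mem_orderIdeal fun a => ?_)⟩
  have h := (SModEq.zero).mp (hv (vanishingOrder ι N K a))
  clear hv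
  induction h using Submodule.smul_induction_on' generalizing i with
  | smul x hx w _ =>
    have h0 := map_eq_zero_of_mem_orderIdeal ((reduceMatrix ι N K a).comp φ) (hpow _ hx)
    rw [MatrixModule.equiv_smul, Matrix.mulVec, dotProduct]
    refine sum_mem fun j _ => Ideal.mul_mem_right _ _ ?_
    exact Ideal.Quotient.eq_zero_iff_mem.mp (congrFun₂ h0 i j)
  | add x _ y _ hx hy =>
    rw [map_add, Pi.add_apply]
    exact add_mem (hx i) (hy i)

theorem exists_sub_mem_span_smul_top (hC : ∀ c, φ (C c) = Matrix.scalar ι (C c))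
    (hX : ∀ i, φ (f i) = Matrix.scalar ι (X i)) (v : MatrixModule φ) :
    v - ∑ i, (C (constantCoeff (MatrixModule.equiv φ v i)) : MvPowerSeries (Fin N) K) •
      (MatrixModule.equiv φ).symm (Pi.single i 1) ∈
        (Ideal.span (Set.range f) • ⊤ : Submodule (MvPowerSeries (Fin N) K) (MatrixModule φ)) := by
  refine (mem_span_smul_top_iff hX).mpr fun i => ?_
  rw [map_sub, map_sum, Pi.sub_apply, Finset.sum_apply, map_sub, map_sum,
    Finset.sum_eq_single i]
  · rw [matrixModule_smul_eq_of_scalar φ (hC _)]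
    simp
  · intro j _ hj
    rw [matrixModule_smul_eq_of_scalar φ (hC _)]
    simp [hj.symm]
  · simp

/-- Complete Nakayama: the standard basis vectors generate modulo the ideal of the f i, the ring is
complete, and the module is separated by automatic continuity. -/
theorem finite_matrixModule [Finite K] (hC : ∀ c, φ (C c) = Matrix.scalar ι (C c))
    (hX : ∀ i, φ (f i) = Matrix.scalar ι (X i)) (hf : ∀ i, constantCoeff (f i) = 0) :
    Module.Finite (MvPowerSeries (Fin N) K) (MatrixModule φ) := by
  have : IsAdicComplete (orderIdeal (Fin N) K 1) (MvPowerSeries (Fin N) K) := by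
    rw [orderIdeal_one_eq_span]
    infer_instance
  have := IsPrecomplete.pi (orderIdeal (Fin N) K 1) ι
  have := isHausdorff_matrixModule (φ := φ)
  let Φ := Fintype.linearCombination (MvPowerSeries (Fin N) K)
    (fun i => (MatrixModule.equiv φ).symm (Pi.single i 1))
  have hle : Ideal.span (Set.range f) ≤ orderIdeal (Fin N) K 1 := by
    rw [Ideal.span_le]
    rintro _ ⟨i, rfl⟩
    exact mem_orderIdeal_one.mpr (hf i)
  refine Module.Finite.of_surjective Φ
    (surjective_of_mkQ_comp_surjective (I := orderIdeal (Fin N) K 1) ?_)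
  intro w
  obtain ⟨v, rfl⟩ := Submodule.mkQ_surjective _ w
  refine ⟨fun i => C (constantCoeff (MatrixModule.equiv φ v i)), Eq.symm ?_⟩
  refine (Submodule.Quotient.eq _).mpr ?_
  exact Submodule.smul_mono_left hle (exists_sub_mem_span_smul_top hC hX v)

theorem isWeaklyRegular_matrixModule (hX : ∀ i, φ (f i) = Matrix.scalar ι (X i)) :
    IsWeaklyRegular (MatrixModule φ) (List.ofFn f) := by
  refine (AddEquiv.isWeaklyRegular_congr (e := MatrixModule.equiv φ) ?_).mpr
    ((isWeaklyRegular_X N).pi ι)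
  rw [List.forall₂_iff_get]
  refine ⟨by simp, fun i h1 h2 x => ?_⟩
  simpa using matrixModule_smul_eq_of_scalar φ (hX ⟨i, by simpa using h1⟩) x

theorem ofList_ofFn {R : Type*} [CommRing R] {n : ℕ} (f : Fin n → R) :
    Ideal.ofList (List.ofFn f) = Ideal.span (Set.range f) := by
  rw [Ideal.ofList]
  congr 1
  ext x
  simp [List.mem_ofFn]

theorem free_matrixModule [Finite K] {α : ℕ}
    {φ : MvPowerSeries (Fin N) K →+* Matrix (Fin α) (Fin α) (MvPowerSeries (Fin N) K)}
    (hC : ∀ c, φ (C c) = Matrix.scalar (Fin α) (C c))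
    (hX : ∀ i, φ (f i) = Matrix.scalar (Fin α) (X i)) (hf : ∀ i, constantCoeff (f i) = 0) :
    Module.Free (MvPowerSeries (Fin N) K) (MatrixModule φ) := by
  have := finite_matrixModule hC hX hf
  refine Module.free_of_isWeaklyRegular isRegular_X ofList_X_eq_maximalIdeal (fs := List.ofFn f)
    (by simp) ?_ (isWeaklyRegular_matrixModule hX) ?_
  · intro x hx
    obtain ⟨i, rfl⟩ := List.mem_ofFn.mp hx
    exact mem_maximalIdeal_iff.mpr (mem_orderIdeal_one.mpr (hf i))
  · rw [ofList_ofFn]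
    have : Finite (MatrixModule φ ⧸ (Ideal.span (Set.range f) • ⊤ :
        Submodule (MvPowerSeries (Fin N) K) (MatrixModule φ))) := by
      refine Finite.of_surjective (α := Fin α → K) (fun c => Submodule.Quotient.mk
        (∑ i, (C (c i) : MvPowerSeries (Fin N) K) • (MatrixModule.equiv φ).symm (Pi.single i 1)))
        fun w => ?_
      obtain ⟨v, rfl⟩ := Submodule.mkQ_surjective _ w
      exact ⟨_, ((Submodule.Quotient.eq _).mpr (exists_sub_mem_span_smul_top hC hX v)).symm⟩
    exact isFiniteLength_iff_isNoetherian_isArtinian.mpr ⟨inferInstance, isArtinian_of_finite⟩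

end Free

end MvPowerSeries

theorem RingTheory.Sequence.IsWeaklyRegular.of_pi {R ι : Type*} [CommRing R] [Finite ι]
    [Nonempty ι] {rs : List R} (h : IsWeaklyRegular (ι → R) rs) : IsWeaklyRegular R rs := by
  refine (isWeaklyRegular_iff_Fin _ _).mpr fun k => ?_
  have hk := (isWeaklyRegular_iff_Fin _ _).mp h k
  rw [isSMulRegular_iff_right_eq_zero_of_smul] at hk ⊢
  intro x
  obtain ⟨x, rfl⟩ := Submodule.mkQ_surjective _ x
  intro hx
  rw [← map_smul, Submodule.mkQ_apply, Submodule.Quotient.mk_eq_zero, smul_eq_mul _ ⊤,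
    Ideal.mul_top] at hx
  have h0 := hk (Submodule.mkQ _ (fun _ : ι => x)) <| by
    rw [← map_smul, Submodule.mkQ_apply, Submodule.Quotient.mk_eq_zero, mem_ideal_smul_top_pi]
    exact fun _ => hx
  rw [Submodule.mkQ_apply, Submodule.Quotient.mk_eq_zero, mem_ideal_smul_top_pi] at h0
  rw [Submodule.mkQ_apply, Submodule.Quotient.mk_eq_zero, smul_eq_mul _ ⊤, Ideal.mul_top]
  exact h0 (Classical.arbitrary ι)

namespace MvPowerSeries

open IsLocalRing RingTheory.Sequence

variable {K : Type*} [Field K] {N α : ℕ}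

/-- The constant coefficient of a power series modulo the series of order at least `n + 1`. -/
def quotientConstantCoeff (N : ℕ) (K : Type*) [Field K] (n : ℕ) :
    MvPowerSeries (Fin N) K ⧸ orderIdeal (Fin N) K (n + 1) →+* K :=
  Ideal.Quotient.lift _ constantCoeff fun _ h =>
    mem_orderIdeal_one.mp (orderIdeal_anti (Nat.le_add_left 1 n) h)

/-! ### Limits of matrix representations -/

section Limit

variable [Finite K]
  (ρ : ∀ n, MvPowerSeries (Fin N) K →+*
    Matrix (Fin α) (Fin α) (MvPowerSeries (Fin N) K ⧸ orderIdeal (Fin N) K (n + 1)))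

/-- The reduction of `ρ n` modulo the series of order at least `a`. -/
def reduceLevel {n a : ℕ} (h : a ≤ n + 1) : MvPowerSeries (Fin N) K →+*
    Matrix (Fin α) (Fin α) (MvPowerSeries (Fin N) K ⧸ orderIdeal (Fin N) K a) :=
  (Ideal.Quotient.factor (orderIdeal_anti h)).mapMatrix.comp (ρ n)

/-- The limit is taken entry by entry and pointwise in x. Each ring identity is checked modulo every
order a, at one level n that computes all terms involved. -/
theorem exists_ultrafilter_limit_hom (U : Ultrafilter ℕ)
    (hU : ∀ a : ℕ, ∀ᶠ n : ℕ in (U : Filter ℕ), a ≤ n) :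
    ∃ φ : MvPowerSeries (Fin N) K →+* Matrix (Fin α) (Fin α) (MvPowerSeries (Fin N) K),
      ∀ x a, ∀ᶠ n in U, ∃ h : a ≤ n + 1,
        reduceLevel ρ h x = reduceMatrix (Fin α) N K a (φ x) := by
  have h (x : MvPowerSeries (Fin N) K) (i j : Fin α) :=
    exists_ultrafilter_limit U fun n => Quotient.out (ρ n x i j)
  choose φ hφ using h
  let φ' (x : MvPowerSeries (Fin N) K) : Matrix (Fin α) (Fin α) (MvPowerSeries (Fin N) K) := φ x
  have key (x a) : ∀ᶠ n in U, ∃ h : a ≤ n + 1,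
      reduceLevel ρ h x = reduceMatrix (Fin α) N K a (φ' x) := by
    filter_upwards [hU a, Filter.eventually_all.mpr fun i => Filter.eventually_all.mpr fun j =>
      hφ x i j a] with n hn h
    refine ⟨hn.trans (Nat.le_succ n), ?_⟩
    ext1 i j
    refine Eq.trans ?_ ((Ideal.Quotient.mk_eq_mk_iff_sub_mem _ _).mpr (h i j))
    refine Eq.trans ?_ (Ideal.Quotient.factor_mk (orderIdeal_anti (hn.trans (Nat.le_succ n))) _)
    rw [Ideal.Quotient.mk_out]
    rfl
  refine ⟨{
    toFun := φ'
    map_one' := ?_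
    map_mul' := fun x y => ?_
    map_zero' := ?_
    map_add' := fun x y => ?_ }, key⟩
  · refine eq_of_forall_reduceMatrix_eq fun a => ?_
    obtain ⟨n, h, h1⟩ := (key 1 a).exists
    rw [← h1, map_one, map_one]
  · refine eq_of_forall_reduceMatrix_eq fun a => ?_
    obtain ⟨n, ⟨h, h1⟩, ⟨_, h2⟩, ⟨_, h3⟩⟩ :=
      ((key (x * y) a).and ((key x a).and (key y a))).exists
    rw [← h1, map_mul, map_mul, h2, h3]
  · refine eq_of_forall_reduceMatrix_eq fun a => ?_
    obtain ⟨n, h, h1⟩ := (key 0 a).exists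
    rw [← h1, map_zero, map_zero]
  · refine eq_of_forall_reduceMatrix_eq fun a => ?_
    obtain ⟨n, ⟨h, h1⟩, ⟨_, h2⟩, ⟨_, h3⟩⟩ :=
      ((key (x + y) a).and ((key x a).and (key y a))).exists
    rw [← h1, map_add, map_add, h2, h3]

/-- The argument u n varies with n; the uniform vanishing order permits replacing it by its limit p
inside ρ n. -/
theorem map_limit_eq_scalar {U : Ultrafilter ℕ}
    {φ : MvPowerSeries (Fin N) K →+* Matrix (Fin α) (Fin α) (MvPowerSeries (Fin N) K)}
    (hφ : ∀ x a, ∀ᶠ n in U, ∃ h : a ≤ n + 1,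
        reduceLevel ρ h x = reduceMatrix (Fin α) N K a (φ x))
    {u : ℕ → MvPowerSeries (Fin N) K} {p y : MvPowerSeries (Fin N) K}
    (hu : ∀ a, ∀ᶠ n in U, u n - p ∈ orderIdeal (Fin N) K a)
    (h : ∀ n, ρ n (u n) = Matrix.scalar (Fin α) (Ideal.Quotient.mk _ y)) :
    φ p = Matrix.scalar (Fin α) y := by
  refine eq_of_forall_reduceMatrix_eq fun a => ?_
  obtain ⟨n, ⟨ha, h1⟩, h2⟩ := ((hφ p a).and (hu (vanishingOrder (Fin α) N K a))).exists
  have h3 := map_eq_zero_of_mem_orderIdeal (reduceLevel ρ ha) h2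
  rw [map_sub, sub_eq_zero] at h3
  rw [← h1, ← h3, reduceLevel, RingHom.comp_apply, h]
  ext i j
  by_cases hij : i = j
  · subst hij; simp
  · simp [hij]

/-- One set of U serves all x at once, because both sides depend only on x modulo order b, and there
are finitely many such classes. -/
theorem eventually_constantCoeff_eq {U : Ultrafilter ℕ}
    {φ : MvPowerSeries (Fin N) K →+* Matrix (Fin α) (Fin α) (MvPowerSeries (Fin N) K)}
    (hφ : ∀ x a, ∀ᶠ n in U, ∃ h : a ≤ n + 1,
        reduceLevel ρ h x = reduceMatrix (Fin α) N K a (φ x)) :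
    ∀ᶠ n in U, ∀ x i j, quotientConstantCoeff N K n (ρ n x i j) = constantCoeff (φ x i j) := by
  let b := vanishingOrder (Fin α) N K 1
  have h (y : MvPowerSeries (Fin N) K ⧸ orderIdeal (Fin N) K b) := hφ (Quotient.out y) 1
  filter_upwards [Filter.eventually_all.mpr h] with n hn x i j
  have hx : x - Quotient.out (Ideal.Quotient.mk (orderIdeal (Fin N) K b) x) ∈
      orderIdeal (Fin N) K b := by
    rw [← Ideal.Quotient.mk_eq_mk_iff_sub_mem, Ideal.Quotient.mk_out]
  obtain ⟨hle, h1⟩ := hn (Ideal.Quotient.mk _ x)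
  have h2 := map_eq_zero_of_mem_orderIdeal (reduceLevel ρ hle) hx
  have h3 := map_eq_zero_of_mem_orderIdeal ((reduceMatrix (Fin α) N K 1).comp φ) hx
  rw [map_sub, sub_eq_zero] at h2 h3
  have h4 : reduceLevel ρ hle x = reduceMatrix (Fin α) N K 1 (φ x) := by
    rw [h2, h1]
    exact h3.symm
  have h5 (z : MvPowerSeries (Fin N) K ⧸ orderIdeal (Fin N) K (n + 1)) :
      quotientConstantCoeff N K n z =
        quotientConstantCoeff N K 0 (Ideal.Quotient.factor (orderIdeal_anti hle) z) := by
    obtain ⟨z, rfl⟩ := Ideal.Quotient.mk_surjective z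
    rfl
  rw [h5]
  exact congrArg (quotientConstantCoeff N K 0) (congrFun₂ h4 i j)

end Limit

/-! ### Patching over the residue field -/

section Patching

/-- **Patching.** Let `ρ n` be representations of a power series ring `K⟦T₁, …, T_N⟧` over a finite
field by matrices over `K⟦S₁, …, S_N⟧` modulo order `n + 1`, in which `S_i` is the image of
`f n i`. Then for some `n` the residual representation is free over a complete
intersection `K⟦T₁, …, T_N⟧ / (g₁, …, g_N)` with `g_i` in the ideal generated by the `f n j`. -/
theorem exists_free_residual_of_matrix_system [Finite K] (hα : 1 ≤ α)
    (ρ : ∀ n, MvPowerSeries (Fin N) K →+*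
      Matrix (Fin α) (Fin α) (MvPowerSeries (Fin N) K ⧸ orderIdeal (Fin N) K (n + 1)))
    (hC : ∀ n c, ρ n (C c) = Matrix.scalar (Fin α) (Ideal.Quotient.mk _ (C c)))
    (f : ℕ → Fin N → MvPowerSeries (Fin N) K) (hf : ∀ n i, constantCoeff (f n i) = 0)
    (hX : ∀ n i, ρ n (f n i) = Matrix.scalar (Fin α) (Ideal.Quotient.mk _ (X i))) :
    ∃ n, ∃ g : Fin N → MvPowerSeries (Fin N) K,
      IsRegular (MvPowerSeries (Fin N) K) (List.ofFn g) ∧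
      (∀ i, g i ∈ Ideal.span (Set.range (f n))) ∧
      ∃ s, 1 ≤ s ∧ ∃ w : Fin s → Fin α → K,
        (∀ y : Fin α → K, ∃ a : Fin s → MvPowerSeries (Fin N) K,
          ∑ j, ((quotientConstantCoeff N K n).mapMatrix (ρ n (a j))).mulVec (w j) = y) ∧
        ∀ a : Fin s → MvPowerSeries (Fin N) K,
          ∑ j, ((quotientConstantCoeff N K n).mapMatrix (ρ n (a j))).mulVec (w j) = 0 →
            ∀ j, a j ∈ Ideal.span (Set.range g) := by
  obtain ⟨U, hU⟩ : ∃ U : Ultrafilter ℕ, ∀ a : ℕ, ∀ᶠ n : ℕ in (U : Filter ℕ), a ≤ n :=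
    ⟨Filter.hyperfilter ℕ, fun a => Filter.Tendsto.eventually
      (Nat.hyperfilter_le_atTop : Filter.Tendsto id _ _) (Filter.eventually_ge_atTop a)⟩
  obtain ⟨φ, hφ⟩ := exists_ultrafilter_limit_hom ρ U hU
  choose g hg using fun i => exists_ultrafilter_limit U fun n => f n i
  have hφC (c) : φ (C c) = Matrix.scalar (Fin α) (C c) :=
    map_limit_eq_scalar ρ hφ (u := fun _ => C c) (fun a => by simp) fun n => hC n c
  have hφX (i) : φ (g i) = Matrix.scalar (Fin α) (X i) :=
    map_limit_eq_scalar ρ hφ (hg i) fun n => hX n i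
  have hg0 (i) : constantCoeff (g i) = 0 := by
    obtain ⟨n, hn⟩ := (hg i 1).exists
    have := mem_orderIdeal_one.mp hn
    rwa [map_sub, hf, zero_sub, neg_eq_zero] at this
  have hfin := finite_matrixModule hφC hφX hg0
  have hfree := free_matrixModule hφC hφX hg0
  have hnt : Nontrivial (MatrixModule φ) := by
    have : Nonempty (Fin α) := ⟨⟨0, hα⟩⟩
    exact inferInstanceAs (Nontrivial (Fin α → MvPowerSeries (Fin N) K))
  let b := Module.finBasis (MvPowerSeries (Fin N) K) (MatrixModule φ)
  have hs : 1 ≤ Module.finrank (MvPowerSeries (Fin N) K) (MatrixModule φ) :=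
    Fin.pos_iff_nonempty.mpr b.index_nonempty
  -- A combination of the basis with zero constant coefficients lies in (g) times the free module,
  -- so its coordinates lie in (g).
  have hker (a : Fin (Module.finrank (MvPowerSeries (Fin N) K) (MatrixModule φ)) →
      MvPowerSeries (Fin N) K)
      (ha : ∀ i, constantCoeff (MatrixModule.equiv φ (∑ j, a j • b j) i) = 0) (j) :
      a j ∈ Ideal.span (Set.range g) := by
    have h := Submodule.smul_top_le_comap_smul_top (Ideal.span (Set.range g)) (b.coord j)
      ((mem_span_smul_top_iff hφX).mpr ha)
    simpa [Module.Basis.coord_apply, Finsupp.single_apply] using h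
  set e := vanishingOrder (Fin α) N K 1 with he
  -- Series of order at least e act as zero on the residual module, which is free of positive rank
  -- over K⟦T⟧/(g).
  have hle : orderIdeal (Fin N) K e ≤ Ideal.span (Set.range g) := by
    intro x hx
    have h0 := map_eq_zero_of_mem_orderIdeal ((reduceMatrix (Fin α) N K 1).comp φ) hx
    refine hker (Pi.single ⟨0, hs⟩ x) (fun i => ?_) ⟨0, hs⟩ |> fun h => by simpa using h
    rw [Finset.sum_eq_single ⟨0, hs⟩ (fun j _ hj => by simp [hj]) (by simp), Pi.single_eq_same,
      MatrixModule.equiv_smul, Matrix.mulVec, dotProduct, map_sum]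
    refine Finset.sum_eq_zero fun j _ => ?_
    rw [map_mul, mem_orderIdeal_one.mp (Ideal.Quotient.eq_zero_iff_mem.mp (congrFun₂ h0 i j)),
      zero_mul]
  -- The order N * (e + 1) + 1 puts f n i - g i in the ideal of the X_j^(e + 1), hence in the
  -- maximal ideal times (g); Nakayama then yields (g) ≤ (f n).
  obtain ⟨n, hn, hfg⟩ := ((eventually_constantCoeff_eq ρ hφ).and
    (Filter.eventually_all.mpr fun i => hg i (N * (e + 1) + 1))).exists
  have hred (x : MvPowerSeries (Fin N) K) (v : MatrixModule φ) :
      ((quotientConstantCoeff N K n).mapMatrix (ρ n x)).mulVec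
        (fun i => constantCoeff (MatrixModule.equiv φ v i)) =
      fun i => constantCoeff (MatrixModule.equiv φ (x • v) i) := by
    funext i
    rw [MatrixModule.equiv_smul]
    simp [Matrix.mulVec, dotProduct, map_sum, map_mul, hn x]
  have hsum (a : Fin (Module.finrank (MvPowerSeries (Fin N) K) (MatrixModule φ)) →
      MvPowerSeries (Fin N) K) :
      ∑ j, ((quotientConstantCoeff N K n).mapMatrix (ρ n (a j))).mulVec
        (fun i => constantCoeff (MatrixModule.equiv φ (b j) i)) =
      fun i => constantCoeff (MatrixModule.equiv φ (∑ j, a j • b j) i) := by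
    funext i
    simp_rw [hred]
    simp [map_sum]
  refine ⟨n, g, ?_, fun i => ?_, _, hs,
    fun j i => constantCoeff (MatrixModule.equiv φ (b j) i), fun y => ?_, fun a ha => ?_⟩
  · refine (isRegular_iff_isWeaklyRegular_of_subset_maximalIdeal fun x hx => ?_).mpr ?_
    · obtain ⟨i, rfl⟩ := List.mem_ofFn.mp hx
      exact mem_maximalIdeal_iff.mpr (mem_orderIdeal_one.mpr (hg0 i))
    · have : Nonempty (Fin (Module.finrank (MvPowerSeries (Fin N) K) (MatrixModule φ))) :=
        ⟨⟨0, hs⟩⟩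
      exact ((b.equivFun.isWeaklyRegular_congr _).mp (isWeaklyRegular_matrixModule hφX)).of_pi
  · refine Submodule.le_of_le_smul_of_le_jacobson_bot (I := maximalIdeal _)
      (N' := Ideal.span (Set.range g)) (Submodule.fg_span (Set.finite_range g))
      (maximalIdeal_le_jacobson ⊥) ?_ (Ideal.subset_span ⟨i, rfl⟩)
    refine Ideal.span_le.mpr ?_
    rintro _ ⟨i, rfl⟩
    rw [← sub_sub_cancel (f n i) (g i)]
    refine sub_mem (Submodule.mem_sup_left (Ideal.subset_span ⟨i, rfl⟩))
      (Submodule.mem_sup_right ?_)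
    have h := orderIdeal_le_span_X_pow N (e + 1) (hfg i)
    refine (Ideal.span_le.mpr ?_ : Ideal.span (Set.range fun j =>
      (X j : MvPowerSeries (Fin N) K) ^ (e + 1)) ≤ _) h
    rintro _ ⟨j, rfl⟩
    change X j ^ (e + 1) ∈ _
    rw [pow_succ']
    exact Submodule.smul_mem_smul (mem_maximalIdeal_iff.mpr (X_mem_orderIdeal j))
      (hle (X_pow_mem_orderIdeal j e))
  · refine ⟨b.repr ((MatrixModule.equiv φ).symm fun i => C (y i)), ?_⟩
    rw [hsum, b.sum_repr]
    simp
  · exact hker a fun i => congrFun ((hsum a).symm.trans ha) i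

end Patching

end MvPowerSeries

/-! ### Lifting from the residue field to o -/

section Lifting

open IsLocalRing

/-- An o-linear section σ of Φ gives the projection z ↦ z - σ(Φ z) onto ker Φ, which carries m_o P
into m_C ker Φ. So the hypothesis modulo m_o P becomes one modulo m_C ker Φ, and Nakayama over C
applies. -/
theorem ker_le_of_forall_exists_sub_mem_smul_top {o C P M : Type*} [CommRing o]
    [IsLocalRing o] [CommRing C] [IsLocalRing C] [Algebra o C] [IsLocalHom (algebraMap o C)]
    [AddCommGroup P] [Module C P] [Module o P] [IsScalarTower o C P] [IsNoetherian C P]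
    [AddCommGroup M] [Module C M] [Module o M] [IsScalarTower o C M] [Module.Projective o M] {Φ : P →ₗ[C] M}
    (hΦ : Function.Surjective Φ) {L : Submodule C P} (hL : L ≤ LinearMap.ker Φ)
    (hker : ∀ x ∈ LinearMap.ker Φ, ∃ y ∈ L, x - y ∈ (maximalIdeal o • ⊤ : Submodule o P)) :
    LinearMap.ker Φ ≤ L := by
  obtain ⟨σ, hσ⟩ := Module.projective_lifting_property (Φ.restrictScalars o) LinearMap.id hΦ
  have hσ' (m : M) : Φ (σ m) = m := LinearMap.congr_fun hσ m
  refine Submodule.le_of_le_smul_of_le_jacobson_bot (I := maximalIdeal C)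
    (IsNoetherian.noetherian _) (maximalIdeal_le_jacobson ⊥) fun x hx => ?_
  obtain ⟨y, hy, hxy⟩ := hker x hx
  have hz : Φ (x - y) = 0 := by
    rw [map_sub, LinearMap.mem_ker.mp hx, LinearMap.mem_ker.mp (hL hy), sub_zero]
  rw [← add_sub_cancel y x]
  refine add_mem (Submodule.mem_sup_left hy) (Submodule.mem_sup_right ?_)
  have hproj : x - y = (x - y) - σ (Φ (x - y)) := by rw [hz, map_zero, sub_zero]
  rw [hproj]
  generalize x - y = z at hxy
  induction hxy using Submodule.smul_induction_on' with
  | smul c hc p _ =>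
    have h1 : (c • p) - σ (Φ (c • p)) = algebraMap o C c • (p - σ (Φ p)) := by
      rw [algebraMap_smul, ← LinearMap.restrictScalars_apply o Φ, map_smul, map_smul, smul_sub]
      rfl
    rw [h1]
    refine Submodule.smul_mem_smul ?_ ?_
    · exact fun h => hc (isUnit_of_map_unit (algebraMap o C) c h)
    · rw [LinearMap.mem_ker, map_sub, hσ', sub_self]
  | add p _ q _ hp hq =>
    rw [map_add, map_add, add_sub_add_comm]
    exact add_mem hp hq

end Lifting

namespace MvPowerSeries

open IsLocalRing

theorem mem_smul_top_of_map_residue_eq_zero {o : Type*} [CommRing o] [IsLocalRing o]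
    [IsNoetherianRing o] {σ : Type*} {p : MvPowerSeries σ o} (hp : map (residue o) p = 0) :
    p ∈ (maximalIdeal o • ⊤ : Submodule o (MvPowerSeries σ o)) := by
  have h := ker_map_le_map_C (σ := σ) (residue o) (IsNoetherian.noetherian _)
    (RingHom.mem_ker.mpr hp)
  rw [ker_residue] at h
  have h2 := Ideal.smul_top_eq_map (R := o) (S := MvPowerSeries σ o) (maximalIdeal o)
  rw [h2]
  exact h

end MvPowerSeries

section Criterion

open IsLocalRing MvPowerSeries

/-- A surjection `o⟦T₁, …, T_N⟧ → R` and an `R`-module `M` free over `o`, such that `M / m_o M` is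
free of positive rank over `k⟦T₁, …, T_N⟧ / (ḡ₁, …, ḡ_N)` for a regular sequence lifting to elements
of the kernel, exhibit `R` as a complete intersection and `M` as a free `R`-module. -/
theorem completeIntersection_and_free_of_residual {o R M : Type*} [CommRing o] [IsLocalRing o]
    [IsNoetherianRing o] [CommRing R] [Algebra o R] [AddCommGroup M] [Module R M] [Module o M]
    [IsScalarTower o R M] [Module.Free o M] [Module.Finite o M] {N : ℕ}
    (π : MvPowerSeries (Fin N) o →ₐ[o] R) (hπ : Function.Surjective π)
    (g : Fin N → MvPowerSeries (Fin N) o) (hg : ∀ i, π (g i) = 0)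
    (hreg : RingTheory.Sequence.IsRegular (MvPowerSeries (Fin N) (ResidueField o))
      (List.ofFn fun i => map (residue o) (g i)))
    {s : ℕ} (hs : 1 ≤ s) (w : Fin s → M)
    (hsurj : ∀ y : M, ∃ a : Fin s → MvPowerSeries (Fin N) o,
      y - ∑ j, π (a j) • w j ∈ (maximalIdeal o • ⊤ : Submodule o M))
    (hinj : ∀ a : Fin s → MvPowerSeries (Fin N) o,
      ∑ j, π (a j) • w j ∈ (maximalIdeal o • ⊤ : Submodule o M) → ∀ j,
        map (residue o) (a j) ∈ Ideal.span (Set.range fun i => map (residue o) (g i))) :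
    IsRelativeCompleteIntersectionDimZero o R ∧ Module.Free R M ∧
      Function.Injective (Algebra.lsmul o o M : R →ₐ[o] Module.End o M) := by
  let _ : Module (MvPowerSeries (Fin N) o) M := Module.compHom M π.toRingHom
  have hsmul (x : MvPowerSeries (Fin N) o) (m : M) : x • m = π x • m := rfl
  have : IsScalarTower o (MvPowerSeries (Fin N) o) M :=
    ⟨fun c x m => by rw [hsmul, hsmul, map_smul, smul_assoc]⟩
  have : IsLocalHom (algebraMap o (MvPowerSeries (Fin N) o)) :=
    ⟨fun c hc => by
      simpa [MvPowerSeries.algebraMap_apply] using hc.map (constantCoeff (σ := Fin N) (R := o))⟩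
  let Φ := Fintype.linearCombination (MvPowerSeries (Fin N) o) w
  have hΦ (a) : Φ a = ∑ j, π (a j) • w j := rfl
  have hΦsurj : Function.Surjective Φ := by
    have h : (⊤ : Submodule o M) ≤ LinearMap.range (Φ.restrictScalars o) := by
      refine Submodule.le_of_le_smul_of_le_jacobson_bot (I := maximalIdeal o)
        Module.Finite.fg_top (maximalIdeal_le_jacobson ⊥) fun y _ => ?_
      obtain ⟨a, ha⟩ := hsurj y
      rw [← add_sub_cancel (∑ j, π (a j) • w j) y]
      exact add_mem (Submodule.mem_sup_left ⟨a, rfl⟩) (Submodule.mem_sup_right ha)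
    exact fun y => h (Submodule.mem_top (x := y))
  have hspan {x : MvPowerSeries (Fin N) o} (hx : x ∈ Ideal.span (Set.range g)) : π x = 0 := by
    refine (Ideal.span_le.mpr ?_ : Ideal.span (Set.range g) ≤ RingHom.ker π) hx
    rintro _ ⟨i, rfl⟩
    exact hg i
  have hker : LinearMap.ker Φ ≤
      (Ideal.span (Set.range g) • ⊤ : Submodule _ (Fin s → MvPowerSeries (Fin N) o)) := by
    refine ker_le_of_forall_exists_sub_mem_smul_top (o := o) hΦsurj (fun a ha => ?_) fun a ha => ?_
    · rw [LinearMap.mem_ker, hΦ]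
      exact Finset.sum_eq_zero fun j _ => by
        rw [hspan (mem_ideal_smul_top_pi.mp ha j), zero_smul]
    · have h := hinj a (by rw [← hΦ, LinearMap.mem_ker.mp ha]; exact zero_mem _)
      have h' (j) : ∃ y ∈ Ideal.span (Set.range g),
          a j - y ∈ (maximalIdeal o • ⊤ : Submodule o (MvPowerSeries (Fin N) o)) := by
        obtain ⟨c, hc⟩ := Ideal.mem_span_range_iff_exists_fun.mp (h j)
        choose c' hc' using fun i => map_surjective' (residue_surjective (R := o)) (c i)
        refine ⟨∑ i, c' i * g i, sum_mem fun i _ =>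
          Ideal.mul_mem_left _ _ (Ideal.subset_span ⟨i, rfl⟩), ?_⟩
        refine mem_smul_top_of_map_residue_eq_zero ?_
        simp [hc', hc]
      choose y hy hay using h'
      refine ⟨y, mem_ideal_smul_top_pi.mpr hy, ?_⟩
      rw [← Finset.univ_sum_single (a - y)]
      exact sum_mem fun j _ => Submodule.smul_top_le_comap_smul_top (maximalIdeal o)
        (LinearMap.single o (fun _ : Fin s => MvPowerSeries (Fin N) o) j) (hay j)
  have hker' {a : Fin s → MvPowerSeries (Fin N) o} (ha : ∑ j, π (a j) • w j = 0) (j) :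
      a j ∈ Ideal.span (Set.range g) := mem_ideal_smul_top_pi.mp (hker ha) j
  -- As s ≥ 1, an x killed by π gives the relation x · w_0 = 0, whose coefficient x must lie in (g).
  have hkerπ : RingHom.ker π = Ideal.span (Set.range g) := by
    refine le_antisymm (fun x hx => ?_) fun x hx => hspan hx
    have h := hker' (a := Pi.single ⟨0, hs⟩ x) (by
      refine Finset.sum_eq_zero fun j _ => ?_
      by_cases hj : j = ⟨0, hs⟩
      · subst hj
        rw [Pi.single_eq_same, RingHom.mem_ker.mp hx, zero_smul]
      · rw [Pi.single_eq_of_ne hj, map_zero, zero_smul]) ⟨0, hs⟩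
    simpa using h
  let Ψ := Fintype.linearCombination R w
  have hΨ : Function.Bijective Ψ := by
    refine ⟨(injective_iff_map_eq_zero Ψ).mpr fun a ha => ?_, fun y => ?_⟩
    · choose b hb using fun j => hπ (a j)
      have h0 := hker' (a := b) (by simp_rw [hb]; exact ha)
      funext j
      rw [← hb j, hspan (h0 j)]
      rfl
    · obtain ⟨a, ha⟩ := hΦsurj y
      exact ⟨fun j => π (a j), ha⟩
  let E := LinearEquiv.ofBijective Ψ hΨ
  -- The first coordinate of M ≅ R^s makes R an o-direct summand of the free o-module M.
  let p : M →ₗ[o] R := (LinearMap.proj (R := R) (φ := fun _ : Fin s => R) ⟨0, hs⟩ ∘ₗ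
    E.symm.toLinearMap).restrictScalars o
  let i : R →ₗ[o] M := (E.toLinearMap ∘ₗ
    LinearMap.single R (fun _ : Fin s => R) ⟨0, hs⟩).restrictScalars o
  have hpi (x : R) : p (i x) = x := by simp [p, i]
  have hproj : Module.Projective o R := Module.Projective.of_split i p (LinearMap.ext hpi)
  refine ⟨⟨inferInstance, Module.Finite.of_surjective p fun x => ⟨i x, hpi x⟩, N, g, ⟨?_⟩, hreg⟩,
    Module.Free.of_equiv E, (injective_iff_map_eq_zero _).mpr fun x hx => ?_⟩
  · exact (Ideal.quotientEquivAlgOfEq o hkerπ.symm).trans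
      (Ideal.quotientKerAlgEquivOfSurjective hπ)
  · rw [← hpi x]
    have h : i x = x • i 1 := by
      simp only [i, LinearMap.coe_restrictScalars]
      rw [← map_smul, smul_eq_mul, mul_one]
    rw [h, show x • i 1 = 0 from LinearMap.congr_fun hx (i 1), map_zero]

end Criterion

/-! ### Presenting complete local algebras as quotients of power series rings -/

section Evaluation

open IsLocalRing

variable {o R : Type*} [CommRing o] [CommRing R] [Algebra o R] {N : ℕ}

/-- Evaluation of polynomials at elements of an ideal `I`, modulo powers. -/
def polynomialQuotientEval (I : Ideal R) (t : Fin N → R) (ht : ∀ i, t i ∈ I) (n : ℕ) :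
    (MvPolynomial (Fin N) o ⧸ MvPolynomial.idealOfVars (Fin N) o ^ n) →ₐ[o] R ⧸ I ^ n :=
  Ideal.quotientMapₐ (I ^ n) (MvPolynomial.aeval t) <| by
    rw [← Ideal.map_le_iff_le_comap, Ideal.map_pow]
    refine Ideal.pow_right_mono ?_ n
    rw [MvPolynomial.idealOfVars, Ideal.map_span, Ideal.span_le]
    rintro _ ⟨_, ⟨i, rfl⟩, rfl⟩
    simpa using ht i

theorem MvPowerSeries.exists_evalHom (I : Ideal R) [IsAdicComplete I R] (t : Fin N → R)
    (ht : ∀ i, t i ∈ I) :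
    ∃ π : MvPowerSeries (Fin N) o →ₐ[o] R, ∀ i, π (MvPowerSeries.X i) = t i := by
  let f (n : ℕ) : MvPowerSeries (Fin N) o →ₐ[o] R ⧸ I ^ n :=
    (polynomialQuotientEval I t ht n).comp
      ((MvPowerSeries.truncTotalAlgHom (Fin N) o n).restrictScalars o)
  have hf {m n : ℕ} (hle : m ≤ n) :
      (Ideal.Quotient.factorₐ o (Ideal.pow_le_pow_right hle)).comp (f n) = f m := by
    ext x
    change Ideal.Quotient.mk (I ^ m) (MvPolynomial.aeval t (x.truncTotal n)) =
      polynomialQuotientEval I t ht m (Ideal.Quotient.mk _ (x.truncTotal m))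
    rw [(Ideal.Quotient.mk_eq_mk_iff_sub_mem _ _).mpr
      (MvPowerSeries.truncTotal_sub_truncTotal_mem_pow_idealOfVars (le_refl m) hle x)]
    rfl
  refine ⟨IsAdicComplete.liftAlgHom I f hf, fun i => ?_⟩
  rw [← sub_eq_zero]
  refine IsHausdorff.haus (I := I) inferInstance _ fun n => ?_
  rw [SModEq.zero, smul_eq_mul, Ideal.mul_top, ← Ideal.Quotient.mk_eq_mk_iff_sub_mem,
    IsAdicComplete.mk_liftAlgHom]
  have h : MvPowerSeries.truncTotalAlgHom (Fin N) o n (MvPowerSeries.X i) =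
      Ideal.Quotient.mk _ (MvPolynomial.X i) := by
    have := (MvPowerSeries.truncTotalAlgHom (Fin N) o n).commutes (MvPolynomial.X i)
    rw [← MvPolynomial.coe_X]
    exact this
  change polynomialQuotientEval I t ht n (MvPowerSeries.truncTotalAlgHom (Fin N) o n _) = _
  rw [h]
  change Ideal.Quotient.mk (I ^ n) (MvPolynomial.aeval t (MvPolynomial.X i)) = _
  rw [MvPolynomial.aeval_X]

theorem aeval_sub_algebraMap_mem_span (t : Fin N → R) (p : MvPolynomial (Fin N) o) :
    MvPolynomial.aeval t p - algebraMap o R (MvPolynomial.constantCoeff p) ∈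
      Ideal.span (Set.range t) := by
  induction p using MvPolynomial.induction_on with
  | C a => simp
  | add p q hp hq =>
    rw [map_add, map_add, map_add, add_sub_add_comm]
    exact add_mem hp hq
  | mul_X p i _ =>
    simpa using Ideal.mul_mem_left (Ideal.span (Set.range t)) (MvPolynomial.aeval t p)
      (Ideal.subset_span (Set.mem_range_self i))

end Evaluation

section Generators

open IsLocalRing

variable {o R : Type*} [CommRing o] [IsLocalRing o] [CommRing R] [Algebra o R]

theorem IsCompleteNoetherianLocalAlgebra.exists_sub_mem [IsLocalRing R]
    (h : IsCompleteNoetherianLocalAlgebra o R) (x : R) :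
    ∃ c : o, x - algebraMap o R c ∈ maximalIdeal R := by
  have := h.isLocalHom
  obtain ⟨c, hc⟩ := h.residue_bijective.2 (residue R x)
  obtain ⟨c, rfl⟩ := residue_surjective c
  refine ⟨c, ?_⟩
  rw [← residue_eq_zero_iff, map_sub, sub_eq_zero, ← hc, ResidueField.map_residue]

theorem IsTopologicallyGeneratedBy.exists_generators [IsLocalRing R]
    (h : IsCompleteNoetherianLocalAlgebra o R) {m : ℕ} (hm : IsTopologicallyGeneratedBy o R m) :
    ∃ t : Fin m → R, (∀ i, t i ∈ maximalIdeal R) ∧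
      ∀ (x : R) (n : ℕ), ∃ y ∈ Algebra.adjoin o (Set.range t), x - y ∈ maximalIdeal R ^ n := by
  obtain ⟨s, hs, hd⟩ := hm
  -- The family is padded with zeros to exactly m generators, then moved into the maximal ideal by
  -- subtracting constants from o.
  let u (i : Fin m) : R := if hi : (i : ℕ) < s.card then (s.equivFin.symm ⟨i, hi⟩ : R) else 0
  have hu {x : R} (hx : x ∈ s) : ∃ i, u i = x :=
    ⟨⟨s.equivFin ⟨x, hx⟩, (s.equivFin ⟨x, hx⟩).2.trans_le hs⟩, by simp [u]⟩
  choose c hc using fun i => h.exists_sub_mem (u i)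
  refine ⟨fun i => u i - algebraMap o R (c i), hc, fun x n => ?_⟩
  obtain ⟨y, hy, hxy⟩ := hd x n
  refine ⟨y, (Algebra.adjoin_le ?_ : Algebra.adjoin o (s : Set R) ≤ _) hy, hxy⟩
  intro x hx
  obtain ⟨i, rfl⟩ := hu hx
  rw [← sub_add_cancel (u i) (algebraMap o R (c i))]
  exact add_mem (Algebra.subset_adjoin ⟨i, rfl⟩) (Subalgebra.algebraMap_mem _ _)

theorem IsTopologicallyGeneratedBy.exists_surjective [IsAdicComplete (maximalIdeal o) o]
    [IsLocalRing R] (h : IsCompleteNoetherianLocalAlgebra o R) {m : ℕ}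
    (hm : IsTopologicallyGeneratedBy o R m) :
    ∃ π : MvPowerSeries (Fin m) o →ₐ[o] R, Function.Surjective π := by
  have := h.isNoetherianRing
  have := h.isAdicComplete
  have := h.isLocalHom
  obtain ⟨t, ht, hd⟩ := hm.exists_generators h
  obtain ⟨π, hπ⟩ := MvPowerSeries.exists_evalHom (o := o) (maximalIdeal R) t ht
  have htm : Ideal.span (Set.range t) ≤ maximalIdeal R := by
    rw [Ideal.span_le]
    rintro _ ⟨i, rfl⟩
    exact ht i
  -- Density modulo the square of the maximal ideal, together with Nakayama, shows that m_o and the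
  -- t_i generate the maximal ideal of R.
  have hmax : maximalIdeal R ≤
      (maximalIdeal o).map (algebraMap o R) ⊔ Ideal.span (Set.range t) := by
    refine Submodule.le_of_le_smul_of_le_jacobson_bot (I := maximalIdeal R)
      (IsNoetherian.noetherian _) (maximalIdeal_le_jacobson ⊥) fun x hx => ?_
    obtain ⟨y, hy, hxy⟩ := hd x 2
    rw [Algebra.adjoin_range_eq_range_aeval] at hy
    obtain ⟨p, rfl⟩ := hy
    have h1 := aeval_sub_algebraMap_mem_span t p
    rw [pow_two] at hxy
    have h2 : algebraMap o R (MvPolynomial.constantCoeff p) ∈ maximalIdeal R := by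
      have := sub_mem (sub_mem hx (Ideal.mul_le_right hxy)) (htm h1)
      simpa using this
    have h3 : MvPolynomial.constantCoeff p ∈ maximalIdeal o := fun hu => h2 (hu.map _)
    rw [← sub_add_cancel x (MvPolynomial.aeval t p)]
    refine add_mem (Submodule.mem_sup_right hxy) (Submodule.mem_sup_left ?_)
    rw [← sub_add_cancel (MvPolynomial.aeval t p)
      (algebraMap o R (MvPolynomial.constantCoeff p))]
    exact add_mem (Submodule.mem_sup_right h1)
      (Submodule.mem_sup_left (Ideal.mem_map_of_mem _ h3))
  let q : o →+* R ⧸ Ideal.span (Set.range t) := (Ideal.Quotient.mk _).comp (algebraMap o R)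
  -- Modulo (t) the maximal ideal is generated by m_o, so completeness of o lifts surjectivity from
  -- the residue field. The same argument in the T-adic topology then gives surjectivity of π.
  have hqsurj : Function.Surjective q := by
    have hnt : Nontrivial (R ⧸ Ideal.span (Set.range t)) :=
      Ideal.Quotient.nontrivial_iff.mpr (ne_top_of_le_ne_top (maximalIdeal.isMaximal R).ne_top htm)
    have hloc : IsLocalRing (R ⧸ Ideal.span (Set.range t)) :=
      IsLocalRing.of_surjective' _ Ideal.Quotient.mk_surjective
    have hne : (maximalIdeal o).map q ≠ ⊤ := by
      refine ne_top_of_le_ne_top (b := maximalIdeal _) (maximalIdeal.isMaximal _).ne_top ?_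
      have : IsLocalHom (Ideal.Quotient.mk (Ideal.span (Set.range t))) :=
        IsLocalHom.of_surjective _ Ideal.Quotient.mk_surjective
      rw [Ideal.map_le_iff_le_comap]
      exact fun c hc hu => hc (isUnit_of_map_unit (algebraMap o R) c
        (isUnit_of_map_unit (Ideal.Quotient.mk (Ideal.span (Set.range t))) _ hu))
    have := IsHausdorff.of_isLocalRing ((maximalIdeal o).map q)
      (R ⧸ Ideal.span (Set.range t)) hne
    refine surjective_of_mk_map_comp_surjective (I := maximalIdeal o) q fun y => ?_
    obtain ⟨y, rfl⟩ := Ideal.Quotient.mk_surjective y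
    obtain ⟨x, rfl⟩ := Ideal.Quotient.mk_surjective y
    obtain ⟨c, hc⟩ := h.exists_sub_mem x
    refine ⟨c, Eq.symm ?_⟩
    refine (Ideal.Quotient.mk_eq_mk_iff_sub_mem _ _).mpr ?_
    change Ideal.Quotient.mk _ x - Ideal.Quotient.mk _ (algebraMap o R c) ∈ _
    rw [← map_sub]
    have h4 := Ideal.mem_map_of_mem (Ideal.Quotient.mk (Ideal.span (Set.range t))) (hmax hc)
    rwa [Ideal.map_sup, Ideal.map_quotient_self, sup_bot_eq, Ideal.map_map] at h4
  have hI : (Ideal.span (Set.range (MvPowerSeries.X : Fin m → MvPowerSeries (Fin m) o))).map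
      π.toRingHom = Ideal.span (Set.range t) := by
    rw [Ideal.map_span, ← Set.range_comp]
    congr 2
    funext i
    exact hπ i
  have hH : IsHausdorff ((Ideal.span (Set.range
      (MvPowerSeries.X : Fin m → MvPowerSeries (Fin m) o))).map π.toRingHom) R := by
    rw [hI]
    exact IsHausdorff.of_isLocalRing _ R
      (ne_top_of_le_ne_top (maximalIdeal.isMaximal R).ne_top htm)
  refine ⟨π, surjective_of_mk_map_comp_surjective (I := Ideal.span (Set.range
    (MvPowerSeries.X : Fin m → MvPowerSeries (Fin m) o))) π.toRingHom fun y => ?_⟩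
  obtain ⟨x, rfl⟩ := Ideal.Quotient.mk_surjective y
  obtain ⟨c, hc⟩ := hqsurj (Ideal.Quotient.mk _ x)
  refine ⟨algebraMap o _ c, (Ideal.Quotient.mk_eq_mk_iff_sub_mem _ _).mpr ?_⟩
  rw [hI, ← Ideal.Quotient.mk_eq_mk_iff_sub_mem, ← hc]
  exact congrArg _ (π.commutes c)

end Generators

/-! ### Independent elements of ℓ-power order in Δ_Q -/

section GroupTheory

theorem ZMod.exists_pow_smul_eq_zero_and_cast_eq_one {ℓ : ℕ} [Fact ℓ.Prime] {n m : ℕ} (hm : m ≠ 0)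
    (h : ℓ ^ n ∣ m) :
    ∃ (z : ZMod m) (a : ℕ), (ℓ ^ a) • z = 0 ∧ ZMod.castHom h (ZMod (ℓ ^ n)) z = 1 := by
  obtain ⟨a, u, hu, rfl⟩ := Nat.exists_eq_pow_mul_and_not_dvd hm ℓ (Fact.out : ℓ.Prime).ne_one
  have hc : u.Coprime (ℓ ^ n) :=
    (Nat.Coprime.pow_left n (((Fact.out : ℓ.Prime).coprime_iff_not_dvd).mpr hu)).symm
  -- A multiple of the prime-to-ℓ part u is killed by ℓ^a; the inverse of u modulo ℓ^n normalizes
  -- its image to 1.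
  refine ⟨((u * ((u : ZMod (ℓ ^ n))⁻¹).val : ℕ) : ZMod (ℓ ^ a * u)), a, ?_, ?_⟩
  · rw [nsmul_eq_mul, ← Nat.cast_mul, ← mul_assoc, Nat.cast_mul, ZMod.natCast_self, zero_mul]
  · rw [map_natCast, Nat.cast_mul, ZMod.natCast_zmod_val, ZMod.coe_mul_inv_eq_one u hc]

theorem exists_units_hom_zmod {k : Type*} [Field k] [Finite k] {ℓ : ℕ} [Fact ℓ.Prime] {n : ℕ}
    (h : ℓ ^ n ∣ Nat.card k - 1) :
    ∃ (θ : kˣ →* Multiplicative (ZMod (ℓ ^ n))) (ζ : kˣ) (a : ℕ),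
      ζ ^ ℓ ^ a = 1 ∧ θ ζ = Multiplicative.ofAdd 1 := by
  have hcard : Nat.card kˣ = Nat.card k - 1 := Nat.card_units k
  rw [← hcard] at h
  obtain ⟨z, a, hz, hz1⟩ := ZMod.exists_pow_smul_eq_zero_and_cast_eq_one Nat.card_pos.ne' h
  let e : Multiplicative (ZMod (Nat.card kˣ)) ≃* kˣ := zmodCyclicMulEquiv inferInstance
  refine ⟨(AddMonoidHom.toMultiplicative
    (ZMod.castHom h (ZMod (ℓ ^ n))).toAddMonoidHom).comp e.symm.toMonoidHom,
    e (Multiplicative.ofAdd z), a, ?_, ?_⟩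
  · rw [← map_pow, ← ofAdd_nsmul, hz, ofAdd_zero, map_one]
  · simpa using congrArg Multiplicative.ofAdd hz1

theorem mem_commSylow_iff {ℓ : ℕ} [Fact ℓ.Prime] {G : Type*} [CommGroup G] {x : G} :
    x ∈ commSylow ℓ G ↔ ∃ a, x ^ ℓ ^ a = 1 :=
  Iff.rfl

/-- Points of a diagonalizable group as characters of its character group. -/
def diagonalizablePointsEquiv (k Y : Type*) [Field k] [CommGroup Y] :
    (Y →* k) ≃* diagonalizablePoints k Y :=
  MonoidAlgebra.liftMulEquiv k k Y

/-- θ evaluates points at the basis characters, and δ j is the j-th coordinate cocharacter applied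
to ζ. The ℓ-power order of ζ puts δ j in the Sylow subgroup. -/
theorem exists_diagonalizablePoints_hom {k Y : Type*} [Field k] [Finite k] [CommGroup Y] {d : ℕ}
    (e : Y ≃* Multiplicative (Fin d → ℤ)) {ℓ : ℕ} [Fact ℓ.Prime] {n : ℕ}
    (h : ℓ ^ n ∣ Nat.card k - 1) :
    ∃ (θ : commSylow ℓ (diagonalizablePoints k Y) →* (Fin d → Multiplicative (ZMod (ℓ ^ n))))
      (δ : Fin d → commSylow ℓ (diagonalizablePoints k Y)),
      ∀ j, θ (δ j) = Pi.mulSingle j (Multiplicative.ofAdd 1) := by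
  obtain ⟨θ, ζ, a, hζ, hθ⟩ := exists_units_hom_zmod h
  let y (j : Fin d) : Y := e.symm (Multiplicative.ofAdd (Pi.single j 1))
  let ev (j : Fin d) : diagonalizablePoints k Y →* kˣ :=
    ((MonoidHom.eval (y j)).comp (diagonalizablePointsEquiv k Y).symm.toMonoidHom).toHomUnits
  let χ (j : Fin d) : Y →* kˣ := ((zpowersHom kˣ ζ).comp
    (AddMonoidHom.toMultiplicative (Pi.evalAddMonoidHom (fun _ : Fin d => ℤ) j))).comp e.toMonoidHom
  have hχ (j : Fin d) (x : Y) : χ j x = ζ ^ (Multiplicative.toAdd (e x) j) := rfl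
  let pt (j : Fin d) : diagonalizablePoints k Y :=
    diagonalizablePointsEquiv k Y ((Units.coeHom k).comp (χ j))
  have hpt (j : Fin d) : pt j ∈ commSylow ℓ (diagonalizablePoints k Y) := by
    refine mem_commSylow_iff.mpr ⟨a, ?_⟩
    rw [← map_pow, ← map_one (diagonalizablePointsEquiv k Y)]
    congr 1
    ext x
    rw [MonoidHom.pow_apply, MonoidHom.comp_apply, hχ, ← map_pow, ← zpow_natCast, ← zpow_mul,
      mul_comm, zpow_mul, zpow_natCast, hζ, one_zpow]
    rfl
  have hev (i j : Fin d) : ev i (pt j) = ζ ^ ((Pi.single i 1 : Fin d → ℤ) j) := by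
    apply Units.ext
    change (diagonalizablePointsEquiv k Y).symm (diagonalizablePointsEquiv k Y
      ((Units.coeHom k).comp (χ j))) (y i) = _
    rw [MulEquiv.symm_apply_apply, MonoidHom.comp_apply, hχ]
    simp [y]
  refine ⟨(MonoidHom.pi fun j => θ.comp (ev j)).comp
    (commSylow ℓ (diagonalizablePoints k Y)).toSubgroup.subtype, fun j => ⟨pt j, hpt j⟩,
    fun j => ?_⟩
  funext i
  change θ (ev i (pt j)) = _
  rw [hev]
  by_cases hij : i = j
  · subst hij
    simp [hθ]
  · rw [Pi.single_eq_of_ne (Ne.symm hij), Pi.mulSingle_eq_of_ne hij, zpow_zero, map_one]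

theorem IsSplitTorus.nonempty_groupLike_mulEquiv {K A : Type*} [Field K] [CommRing A]
    [HopfAlgebra K A] {d : ℕ} (h : IsSplitTorus K A d) :
    Nonempty (GroupLike K A ≃* Multiplicative (Fin d → ℤ)) := by
  obtain ⟨φ⟩ := h
  let f : Multiplicative (Fin d → ℤ) →* GroupLike K A :=
    { toFun := fun g => ⟨φ.symm (MonoidAlgebra.of K _ g),
        (MonoidAlgebra.isGroupLikeElem_of (R := K) (A := K) g).map φ.symm⟩
      map_one' := GroupLike.val_injective
        ((congrArg φ.symm (map_one (MonoidAlgebra.of K _))).trans (map_one φ.symm))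
      map_mul' := fun g g' => GroupLike.val_injective
        ((congrArg φ.symm (map_mul (MonoidAlgebra.of K _) g g')).trans (map_mul φ.symm _ _)) }
  refine ⟨(MulEquiv.ofBijective f ⟨fun g g' hgg => ?_, fun x => ?_⟩).symm⟩
  · exact MonoidAlgebra.of_injective (φ.symm.injective (congrArg GroupLike.val hgg))
  · obtain ⟨g, hg⟩ := MonoidAlgebra.isGroupLikeElem_iff_mem_range_of.mp (x.2.map φ)
    refine ⟨g, GroupLike.val_injective ?_⟩
    change φ.symm (MonoidAlgebra.of K _ g) = x.1
    rw [hg]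
    exact φ.symm_apply_apply _

end GroupTheory

section Places

variable {F : Type*} [Field F] {A : Type*} [CommRing A] [HopfAlgebra F A] {ℓ : ℕ} [Fact ℓ.Prime]

theorem exists_deltaPlace_hom {d : ℕ} {v : FinPlace F} (hv : IsSplitAt A v d) {n : ℕ} (hn : n ≠ 0)
    (hq : v.q ≡ 1 [MOD ℓ ^ n]) :
    ∃ (θ : DeltaPlace A ℓ v →* (Fin d → Multiplicative (ZMod (ℓ ^ n))))
      (δ : Fin d → DeltaPlace A ℓ v), ∀ j, θ (δ j) = Pi.mulSingle j (Multiplicative.ofAdd 1) := by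
  -- An infinite residue field would have `v.q = 0`, which the congruence excludes because n ≠ 0.
  have hq0 : v.q ≠ 0 := by
    intro h0
    rw [h0] at hq
    have := (Nat.modEq_zero_iff_dvd.mp hq.symm)
    exact (Nat.one_lt_pow hn (Fact.out : ℓ.Prime).one_lt).ne' (Nat.dvd_one.mp this)
  have hfin : Finite v.residueField := Nat.finite_of_card_ne_zero hq0
  obtain ⟨e⟩ := hv.nonempty_groupLike_mulEquiv
  exact exists_diagonalizablePoints_hom e
    ((Nat.modEq_iff_dvd' (Nat.one_le_iff_ne_zero.mpr hq0)).mp hq.symm)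

theorem exists_deltaSet_hom {d r : ℕ} {Q : Finset (FinPlace F)} (hr : Q.card = r)
    (hv : ∀ v ∈ Q, IsSplitAt A v d) {n : ℕ} (hn : n ≠ 0) (hq : ∀ v ∈ Q, v.q ≡ 1 [MOD ℓ ^ n]) :
    ∃ (θ : DeltaSet A ℓ Q →* (Fin (d * r) → Multiplicative (ZMod (ℓ ^ n))))
      (δ : Fin (d * r) → DeltaSet A ℓ Q),
      ∀ j, θ (δ j) = Pi.mulSingle j (Multiplicative.ofAdd 1) := by
  classical
  choose θ δ h using fun v : {v // v ∈ Q} => exists_deltaPlace_hom (hv v v.2) hn (hq v v.2)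
  let E : Fin (d * r) ≃ Fin d × {v // v ∈ Q} :=
    finProdFinEquiv.symm.trans ((Equiv.refl _).prodCongr (Q.equivFinOfCardEq hr).symm)
  refine ⟨MonoidHom.pi fun i => ((Pi.evalMonoidHom _ (E i).1).comp (θ (E i).2)).comp
    (Pi.evalMonoidHom _ (E i).2), fun i => Pi.mulSingle (E i).2 (δ (E i).2 (E i).1), fun j => ?_⟩
  funext i
  change θ (E i).2 ((Pi.mulSingle (E j).2 (δ (E j).2 (E j).1) : DeltaSet A ℓ Q) (E i).2) (E i).1 = _
  by_cases hij : i = j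
  · subst hij
    simp [h]
  · rw [Pi.mulSingle_eq_of_ne hij]
    by_cases h2 : (E i).2 = (E j).2
    · have h1 : (E i).1 ≠ (E j).1 := fun h1 => hij (E.injective (Prod.ext h1 h2))
      rw [h2, Pi.mulSingle_eq_same, h, Pi.mulSingle_eq_of_ne h1]
    · rw [Pi.mulSingle_eq_of_ne h2, map_one, Pi.one_apply]

theorem DeltaSet.exists_pow_eq_one {Q : Finset (FinPlace F)} (x : DeltaSet A ℓ Q) :
    ∃ a, x ^ ℓ ^ a = 1 := by
  classical
  have h (v : {v // v ∈ Q}) : ∃ a, x v ^ ℓ ^ a = 1 := by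
    obtain ⟨a, ha⟩ := mem_commSylow_iff.mp (x v).2
    exact ⟨a, Subtype.ext ha⟩
  choose a ha using h
  refine ⟨∑ v, a v, funext fun v => ?_⟩
  rw [Pi.pow_apply, ← Finset.add_sum_erase _ _ (Finset.mem_univ v), pow_add, pow_mul, ha, one_pow]
  rfl

end Places

theorem exists_zmod_monoidHom {B : Type*} [Monoid B] {m : ℕ} [NeZero m] {x : B} (hx : x ^ m = 1) :
    ∃ h : Multiplicative (ZMod m) →* B, h (Multiplicative.ofAdd 1) = x := by
  refine ⟨{
    toFun := fun z => x ^ (Multiplicative.toAdd z).val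
    map_one' := by simp
    map_mul' := fun y z => by
      rw [toAdd_mul, ZMod.val_add, ← pow_eq_pow_mod _ hx, pow_add] }, ?_⟩
  change x ^ (1 : ZMod m).val = x
  rw [ZMod.val_one_eq_one_mod, ← pow_eq_pow_mod _ hx, pow_one]

theorem eq_one_of_pow_char_pow_eq_one {K : Type*} [Field K] {ℓ : ℕ} [Fact ℓ.Prime] [CharP K ℓ]
    {x : K} {a : ℕ} (h : x ^ ℓ ^ a = 1) : x = 1 := by
  have h2 : (x - 1) ^ ℓ ^ a = 0 := by rw [sub_pow_char_pow, h, one_pow, sub_self]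
  exact sub_eq_zero.mp (pow_eq_zero_iff (pow_ne_zero a (Fact.out : ℓ.Prime).ne_zero) |>.mp h2)

namespace MvPowerSeries

/-- In characteristic ℓ the power is 1 + X_i^(ℓ^n), and ℓ^n ≥ n. -/
theorem one_add_X_pow_eq_one {K : Type*} [Field K] {ℓ : ℕ} [Fact ℓ.Prime] [CharP K ℓ] {N : ℕ}
    (n : ℕ) (i : Fin N) :
    (Ideal.Quotient.mk (orderIdeal (Fin N) K n) (1 + X i)) ^ ℓ ^ n = 1 := by
  have : CharP (MvPowerSeries (Fin N) K) ℓ :=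
    charP_of_injective_ringHom (f := (C : K →+* MvPowerSeries (Fin N) K)) C_injective ℓ
  rw [← map_pow, add_pow_char_pow, one_pow, map_add, map_one,
    Ideal.Quotient.eq_zero_iff_mem.mpr (orderIdeal_anti
      (Nat.lt_pow_self (Fact.out : ℓ.Prime).one_lt).le (X_pow_mem_orderIdeal i _)), add_zero]

end MvPowerSeries

/-! ### The matrix representation at a finite level -/

section Level

open IsLocalRing MvPowerSeries

variable {o : Type*} [CommRing o] [IsLocalRing o] {ℓ : ℕ} [Fact ℓ.Prime] [CharP (ResidueField o) ℓ]
  {Δ : Type*} [CommGroup Δ] {N : ℕ}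

theorem exists_groupRing_hom {n : ℕ} (θ : Δ →* (Fin N → Multiplicative (ZMod (ℓ ^ (n + 1)))))
    {δ : Fin N → Δ} (hδ : ∀ j, θ (δ j) = Pi.mulSingle j (Multiplicative.ofAdd 1)) :
    ∃ χ : MonoidAlgebra o Δ →+*
        MvPowerSeries (Fin N) (ResidueField o) ⧸ orderIdeal (Fin N) (ResidueField o) (n + 1),
      (∀ c, χ (algebraMap o _ c) = Ideal.Quotient.mk _ (C (residue o c))) ∧
      ∀ j, χ (MonoidAlgebra.of o Δ (δ j)) = Ideal.Quotient.mk _ (1 + X j) := by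
  classical
  choose h hh using fun j : Fin N =>
    exists_zmod_monoidHom (one_add_X_pow_eq_one (K := ResidueField o) (ℓ := ℓ) (n + 1) j)
  let g : Δ →* MvPowerSeries (Fin N) (ResidueField o) ⧸
      orderIdeal (Fin N) (ResidueField o) (n + 1) :=
    ∏ j, (h j).comp ((Pi.evalMonoidHom _ j).comp θ)
  have hg (j : Fin N) : g (δ j) = Ideal.Quotient.mk _ (1 + X j) := by
    rw [MonoidHom.finsetProd_apply, Finset.prod_eq_single j]
    · simp [hδ, hh]
    · intro i _ hij
      simp [hδ, hij]
    · simp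
  refine ⟨MonoidAlgebra.liftNCRingHom ((Ideal.Quotient.mk _).comp (C.comp (residue o))) g
    fun _ _ => Commute.all _ _, fun c => ?_, fun j => ?_⟩
  · rw [MonoidAlgebra.coe_algebraMap]
    simp [MonoidAlgebra.liftNCRingHom]
  · rw [MonoidAlgebra.of_apply]
    simp [MonoidAlgebra.liftNCRingHom, hg]

/-- The augmentation of a group ring. -/
abbrev augmentation (o Δ : Type*) [CommRing o] [CommGroup Δ] : MonoidAlgebra o Δ →ₐ[o] o :=
  Bialgebra.counitAlgHom o (MonoidAlgebra o Δ)

/-- A field of characteristic ℓ has no nontrivial ℓ-power roots of unity, so Δ maps to 1. -/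
theorem ringHom_eq_residue_comp_augmentation (hΔ : ∀ x : Δ, ∃ a, x ^ ℓ ^ a = 1)
    (f : MonoidAlgebra o Δ →+* ResidueField o) (hf : ∀ c, f (algebraMap o _ c) = residue o c)
    (x : MonoidAlgebra o Δ) : f x = residue o (augmentation o Δ x) := by
  have : f = (residue o).comp (augmentation o Δ).toRingHom := by
    refine MonoidAlgebra.ringHom_ext (fun c => ?_) fun g => ?_
    · have := hf c
      rw [MonoidAlgebra.coe_algebraMap] at this
      simpa using this
    · obtain ⟨a, ha⟩ := hΔ g
      have h1 : f (MonoidAlgebra.of o Δ g) = 1 := by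
        refine eq_one_of_pow_char_pow_eq_one (ℓ := ℓ) (a := a) ?_
        rw [← map_pow, ← map_pow, ha, map_one, map_one]
      rw [MonoidAlgebra.of_apply] at h1
      simp [h1]
  rw [this]
  rfl

variable {S : Type*} [CommRing S] [Algebra o S] [Algebra (MonoidAlgebra o Δ) S]

theorem algebraMap_of_sub_one_mem_maximalIdeal [IsLocalRing S] [IsLocalHom (algebraMap o S)]
    (hΔ : ∀ x : Δ, ∃ a, x ^ ℓ ^ a = 1) (g : Δ) :
    algebraMap (MonoidAlgebra o Δ) S (MonoidAlgebra.of o Δ g - 1) ∈ maximalIdeal S := by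
  have : CharP (ResidueField S) ℓ :=
    charP_of_injective_ringHom (ResidueField.map (algebraMap o S)).injective ℓ
  obtain ⟨a, ha⟩ := hΔ g
  rw [← residue_eq_zero_iff, map_sub, map_sub, map_one, map_one, sub_eq_zero]
  refine eq_one_of_pow_char_pow_eq_one (ℓ := ℓ) (a := a) ?_
  rw [← map_pow, ← map_pow, ← map_pow, ha, map_one, map_one, map_one]

variable [IsScalarTower o (MonoidAlgebra o Δ) S] {W : Type*} [AddCommGroup W] [Module S W]
  [Module (MonoidAlgebra o Δ) W] [IsScalarTower (MonoidAlgebra o Δ) S W] {α : ℕ}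

/-- S acts on W by matrices over o[Δ] in the basis b, and χ carries their entries to power series
modulo order n + 1. The last clause says that the constant coefficients of ρ recover the action
modulo m_o and the augmentation ideal. -/
theorem exists_matrix_representation [IsNoetherianRing o] [IsLocalRing S]
    [IsLocalHom (algebraMap o S)]
    (hΔ : ∀ x : Δ, ∃ a, x ^ ℓ ^ a = 1) {n : ℕ}
    (θ : Δ →* (Fin N → Multiplicative (ZMod (ℓ ^ (n + 1)))))
    {δ : Fin N → Δ} (hδ : ∀ j, θ (δ j) = Pi.mulSingle j (Multiplicative.ofAdd 1))
    (π : MvPowerSeries (Fin N) o →ₐ[o] S) (hπ : Function.Surjective π)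
    (b : Module.Basis (Fin α) (MonoidAlgebra o Δ) W) :
    ∃ (ρ : MvPowerSeries (Fin N) (ResidueField o) →+* Matrix (Fin α) (Fin α)
        (MvPowerSeries (Fin N) (ResidueField o) ⧸ orderIdeal (Fin N) (ResidueField o) (n + 1)))
      (f : Fin N → MvPowerSeries (Fin N) o),
      (∀ c, ρ (C c) = Matrix.scalar (Fin α) (Ideal.Quotient.mk _ (C c))) ∧
      (∀ i, constantCoeff (map (residue o) (f i)) = 0) ∧
      (∀ i, ρ (map (residue o) (f i)) = Matrix.scalar (Fin α) (Ideal.Quotient.mk _ (X i))) ∧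
      (∀ i, π (f i) ∈ (augmentationIdeal o Δ).map (algebraMap (MonoidAlgebra o Δ) S)) ∧
      ∀ x m i, residue o (augmentation o Δ (b.repr (π x • m) i)) =
        ((quotientConstantCoeff N (ResidueField o) n).mapMatrix (ρ (map (residue o) x))).mulVec
          (fun j => residue o (augmentation o Δ (b.repr m j))) i := by
  obtain ⟨χ, hχ, hχδ⟩ := exists_groupRing_hom (o := o) θ hδ
  have hκ := ringHom_eq_residue_comp_augmentation hΔ
    ((quotientConstantCoeff N (ResidueField o) n).comp χ) fun c => by
      rw [RingHom.comp_apply, hχ]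
      exact constantCoeff_C (σ := Fin N) (residue o c)
  let μ : S →ₐ[MonoidAlgebra o Δ] Matrix (Fin α) (Fin α) (MonoidAlgebra o Δ) :=
    AlgHom.comp (LinearMap.toMatrixAlgEquiv b : Module.End (MonoidAlgebra o Δ) W →ₐ[_] _)
      (Algebra.lsmul (MonoidAlgebra o Δ) (MonoidAlgebra o Δ) W)
  let ρ₀ := χ.mapMatrix.comp (μ.toRingHom.comp π.toRingHom)
  have hscalar (y : MonoidAlgebra o Δ) : χ.mapMatrix (μ (algebraMap (MonoidAlgebra o Δ) S y)) =
      Matrix.scalar (Fin α) (χ y) := by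
    rw [μ.commutes]
    ext i j
    by_cases hij : i = j
    · subst hij; simp [Matrix.algebraMap_matrix_apply]
    · simp [Matrix.algebraMap_matrix_apply, hij]
  have hρC (c : o) : ρ₀ (C c) = Matrix.scalar (Fin α) (Ideal.Quotient.mk _ (C (residue o c))) := by
    rw [← hχ, ← hscalar]
    change χ.mapMatrix (μ (π (C c))) = _
    rw [← IsScalarTower.algebraMap_apply o (MonoidAlgebra o Δ) S, ← π.commutes]
    rfl
  -- The target is killed by m_o, so the representation of o⟦T⟧ descends to the residue field.
  have hker : RingHom.ker (map (σ := Fin N) (residue o)) ≤ RingHom.ker ρ₀ := by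
    refine (ker_map_le_map_C (residue o) (IsNoetherian.noetherian _)).trans ?_
    rw [Ideal.map_le_iff_le_comap]
    intro c hc
    rw [Ideal.mem_comap, RingHom.mem_ker, hρC, RingHom.mem_ker.mp hc]
    simp
  let ρ := (map (σ := Fin N) (residue o)).liftOfSurjective
    (map_surjective' residue_surjective) ⟨ρ₀, hker⟩
  have hρ (x) : ρ (map (residue o) x) = ρ₀ x :=
    RingHom.liftOfRightInverse_comp_apply _ _ _ ⟨ρ₀, hker⟩ x
  -- f i lifts δ_i - 1, which acts through χ as X_i and dies in the quotient of S by the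
  -- augmentation ideal.
  choose f hf using fun i => hπ (algebraMap (MonoidAlgebra o Δ) S (MonoidAlgebra.of o Δ (δ i) - 1))
  refine ⟨ρ, f, fun c => ?_, fun i => ?_, fun i => ?_, fun i => ?_, fun x m i => ?_⟩
  · obtain ⟨c, rfl⟩ := residue_surjective c
    rw [← map_C, hρ, hρC, map_C]
  · rw [← coeff_zero_eq_constantCoeff_apply, coeff_map, residue_eq_zero_iff,
      coeff_zero_eq_constantCoeff_apply]
    intro hu
    have h1 := (isUnit_iff_constantCoeff.mpr hu).map π
    rw [hf] at h1
    exact algebraMap_of_sub_one_mem_maximalIdeal hΔ (δ i) h1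
  · rw [hρ]
    change χ.mapMatrix (μ (π (f i))) = _
    rw [hf, hscalar, map_sub, map_one, hχδ, map_add, map_one, add_sub_cancel_left]
  · rw [hf]
    refine Ideal.mem_map_of_mem _ ?_
    rw [augmentationIdeal, RingHom.mem_ker, map_sub, map_one, MonoidAlgebra.of_apply]
    simp
  · have h1 : b.repr (π x • m) = (μ (π x)).mulVec (b.repr m) :=
      (LinearMap.toMatrix_mulVec_repr b b
        (Algebra.lsmul (MonoidAlgebra o Δ) (MonoidAlgebra o Δ) W (π x)) m).symm
    rw [h1, ← hκ, hρ]
    simp only [Matrix.mulVec, dotProduct, map_sum, map_mul, hκ]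
    refine Finset.sum_congr rfl fun j _ => ?_
    rw [← hκ]
    rfl

end Level

/-- The quotient of W by the augmentation ideal is M by way of q, and o^α by way of the basis and
the augmentation. The equivalence L compares the two. -/
theorem exists_coordinates {o Δ S W : Type*} [CommRing o] [CommGroup Δ] [CommRing S] [Algebra o S]
    [Algebra (MonoidAlgebra o Δ) S] [IsScalarTower o (MonoidAlgebra o Δ) S] [AddCommGroup W]
    [Module S W] [Module (MonoidAlgebra o Δ) W] [IsScalarTower (MonoidAlgebra o Δ) S W]
    [Module o W] [IsScalarTower o S W] {α : ℕ} {M : Type*} [AddCommGroup M]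
    [Module o M] (b : Module.Basis (Fin α) (MonoidAlgebra o Δ) W) {q : W →ₗ[o] M}
    (hq : Function.Surjective q)
    (hker : ∀ m, q m = 0 ↔ m ∈ ((augmentationIdeal o Δ).map (algebraMap (MonoidAlgebra o Δ) S) •
      (⊤ : Submodule S W))) :
    ∃ L : M ≃ₗ[o] (Fin α → o), ∀ m i, L (q m) i = augmentation o Δ (b.repr m i) := by
  have : IsScalarTower o (MonoidAlgebra o Δ) W := ⟨fun c x m => by
    rw [← algebraMap_smul S (c • x) m, ← algebraMap_smul S x m, ← smul_assoc]
    congr 1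
    exact map_smul (IsScalarTower.toAlgHom o (MonoidAlgebra o Δ) S) c x⟩
  let γ : W →ₗ[o] (Fin α → o) :=
    LinearMap.pi fun i => (augmentation o Δ).toLinearMap ∘ₗ (b.coord i).restrictScalars o
  have hγ (m i) : γ m i = augmentation o Δ (b.repr m i) := rfl
  have hγs : Function.Surjective γ := fun v => by
    refine ⟨b.equivFun.symm fun i => algebraMap o _ (v i), ?_⟩
    ext i
    rw [hγ, ← b.equivFun_apply, LinearEquiv.apply_symm_apply, AlgHom.commutes]
    rfl
  have hkill : ∀ s ∈ (augmentationIdeal o Δ).map (algebraMap (MonoidAlgebra o Δ) S),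
      ∀ m : W, γ (s • m) = 0 := fun s hs => by
    induction hs using Submodule.span_induction with
    | mem s hs =>
      obtain ⟨x, hx, rfl⟩ := hs
      intro m
      ext i
      rw [algebraMap_smul, hγ, map_smul, Finsupp.smul_apply, smul_eq_mul, map_mul,
        show augmentation o Δ x = 0 from hx, zero_mul, Pi.zero_apply]
    | zero => simp
    | add s t _ _ hs ht => intro m; rw [add_smul, map_add, hs, ht, add_zero]
    | smul a s _ hs => intro m; rw [smul_eq_mul, mul_comm, mul_smul, hs]
  have hker' : LinearMap.ker q = LinearMap.ker γ := by
    ext m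
    rw [LinearMap.mem_ker, LinearMap.mem_ker, hker]
    refine ⟨fun hm => ?_, fun hm => ?_⟩
    · induction hm using Submodule.smul_induction_on' with
      | smul s hs m _ => exact hkill s hs m
      | add m _ m' _ hm hm' => rw [map_add, hm, hm', add_zero]
    · rw [← b.sum_repr m]
      refine sum_mem fun i _ => ?_
      rw [← algebraMap_smul S (b.repr m i) (b i)]
      refine Submodule.smul_mem_smul (Ideal.mem_map_of_mem _ ?_) Submodule.mem_top
      exact congr_fun hm i
  refine ⟨(q.quotKerEquivOfSurjective hq).symm ≪≫ₗ Submodule.quotEquivOfEq _ _ hker' ≪≫ₗ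
    γ.quotKerEquivOfSurjective hγs, fun m i => ?_⟩
  have h1 : (q.quotKerEquivOfSurjective hq).symm (q m) = Submodule.Quotient.mk m := by
    rw [LinearEquiv.symm_apply_eq]
    rfl
  rw [LinearEquiv.trans_apply, LinearEquiv.trans_apply, h1]
  rfl

/-! ### Patching a Taylor–Wiles system -/

section Patching

open IsLocalRing MvPowerSeries

theorem mem_maximalIdeal_smul_top_iff {o M : Type*} [CommRing o] [IsLocalRing o] [AddCommGroup M]
    [Module o M] {α : ℕ} (L : M ≃ₗ[o] (Fin α → o)) (m : M) :
    m ∈ (maximalIdeal o • ⊤ : Submodule o M) ↔ ∀ i, residue o (L m i) = 0 := by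
  simp_rw [residue_eq_zero_iff, ← mem_ideal_smul_top_pi]
  refine ⟨fun h => Submodule.smul_top_le_comap_smul_top _ L.toLinearMap h, fun h => ?_⟩
  simpa using Submodule.smul_top_le_comap_smul_top _ L.symm.toLinearMap h

theorem exists_matrix_level {ℓ : ℕ} [Fact ℓ.Prime] {o : Type*} [CommRing o] [IsLocalRing o]
    [IsNoetherianRing o] [CharP (ResidueField o) ℓ] {R M : Type*} [CommRing R] [Algebra o R]
    [AddCommGroup M] [Module R M] [Module o M]
    {Δ S W : Type*} [CommGroup Δ] [CommRing S] [Algebra o S] [IsLocalRing S]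
    [IsLocalHom (algebraMap o S)] [Algebra (MonoidAlgebra o Δ) S]
    [IsScalarTower o (MonoidAlgebra o Δ) S] [AddCommGroup W] [Module S W]
    [Module (MonoidAlgebra o Δ) W] [IsScalarTower (MonoidAlgebra o Δ) S W]
    [Module o W] [IsScalarTower o S W] {α N n : ℕ} (hΔ : ∀ x : Δ, ∃ a, x ^ ℓ ^ a = 1)
    (θ : Δ →* (Fin N → Multiplicative (ZMod (ℓ ^ (n + 1)))))
    {δ : Fin N → Δ} (hδ : ∀ j, θ (δ j) = Pi.mulSingle j (Multiplicative.ofAdd 1))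
    (π : MvPowerSeries (Fin N) o →ₐ[o] S) (hπ : Function.Surjective π)
    (b : Module.Basis (Fin α) (MonoidAlgebra o Δ) W)
    (t : (S ⧸ (augmentationIdeal o Δ).map (algebraMap (MonoidAlgebra o Δ) S)) →ₐ[o] R)
    (ht : Function.Surjective t)
    (h : ∃ ψ : R →ₐ[o] Module.End o (W ⧸ ((augmentationIdeal o Δ).map
        (algebraMap (MonoidAlgebra o Δ) S) • (⊤ : Submodule S W))),
      (∀ a : S, ψ (t (Ideal.Quotient.mk _ a)) = Algebra.lsmul o o _ a) ∧
      ∃ e : (W ⧸ ((augmentationIdeal o Δ).map (algebraMap (MonoidAlgebra o Δ) S) •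
          (⊤ : Submodule S W))) ≃ₗ[o] M,
        ∀ (a : R) (x), e (ψ a x) = a • e x) :
    ∃ (ρ : MvPowerSeries (Fin N) (ResidueField o) →+* Matrix (Fin α) (Fin α)
        (MvPowerSeries (Fin N) (ResidueField o) ⧸
          orderIdeal (Fin N) (ResidueField o) (n + 1)))
      (f : Fin N → MvPowerSeries (Fin N) o)
      (ϖ : MvPowerSeries (Fin N) o →ₐ[o] R) (L : M ≃ₗ[o] (Fin α → o)),
      (∀ c, ρ (C c) = Matrix.scalar (Fin α) (Ideal.Quotient.mk _ (C c))) ∧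
      (∀ i, constantCoeff (map (residue o) (f i)) = 0) ∧
      (∀ i, ρ (map (residue o) (f i)) =
        Matrix.scalar (Fin α) (Ideal.Quotient.mk _ (MvPowerSeries.X i))) ∧
      Function.Surjective ϖ ∧ (∀ i, ϖ (f i) = 0) ∧
      ∀ x m i, residue o (L (ϖ x • m) i) =
        ((quotientConstantCoeff N (ResidueField o) n).mapMatrix
          (ρ (map (residue o) x))).mulVec (fun j => residue o (L m j)) i := by
  obtain ⟨ρ, f, hρC, hf, hρX, hfI, hρ⟩ := exists_matrix_representation hΔ θ hδ π hπ b
  obtain ⟨ψ, hψ, e, he⟩ := h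
  obtain ⟨q, hqe⟩ : ∃ q : W →ₗ[o] M, ∀ m, q m = e (Submodule.Quotient.mk m) :=
    ⟨e.toLinearMap ∘ₗ (Submodule.mkQ _).restrictScalars o, fun _ => rfl⟩
  have hqs : Function.Surjective q := fun m => by
    obtain ⟨w, hw⟩ := Submodule.mkQ_surjective _ (e.symm m)
    exact ⟨w, by rw [hqe, ← Submodule.mkQ_apply, hw, e.apply_symm_apply]⟩
  obtain ⟨L, hL⟩ := exists_coordinates b hqs fun m => by
    rw [hqe, LinearEquiv.map_eq_zero_iff, Submodule.Quotient.mk_eq_zero]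
  have hq (x m) : t (Ideal.Quotient.mk _ (π x)) • q m = q (π x • m) := by
    rw [hqe, hqe, ← he, hψ]
    rfl
  refine ⟨ρ, f, t.comp ((Ideal.Quotient.mkₐ o _).comp π), L, hρC, hf, hρX,
    ht.comp (Ideal.Quotient.mk_surjective.comp hπ), fun i => ?_, fun x m i => ?_⟩
  · change t (Ideal.Quotient.mk _ (π (f i))) = 0
    rw [Ideal.Quotient.eq_zero_iff_mem.mpr (hfI i), map_zero]
  · obtain ⟨m, rfl⟩ := hqs m
    change residue o (L (t (Ideal.Quotient.mk _ (π x)) • q m) i) = _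
    simp only [hq, hL, hρ]

variable {F : Type*} [Field F] {A : Type*} [CommRing A] [HopfAlgebra F A] {d ℓ : ℕ}
  [Fact ℓ.Prime] {o : Type*} [CommRing o] [IsLocalRing o] [IsNoetherianRing o]
  [IsAdicComplete (maximalIdeal o) o] [CharP (ResidueField o) ℓ] {X : Set (Finset (FinPlace F))}
  {R : Type*} [CommRing R] [Algebra o R] {M : Type*} [AddCommGroup M] [Module R M] [Module o M]
  [IsScalarTower o R M]

theorem TaylorWilesSystem.exists_level (T : TaylorWilesSystem F A d ℓ o X R M)
    (h_infinite : ∀ n : ℕ, {Q ∈ X | ∀ v ∈ Q, v.q ≡ 1 [MOD ℓ ^ n]}.Infinite)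
    {r : ℕ} (h_card : ∀ Q ∈ X, Q ≠ ∅ → Q.card = r)
    (h_gen : ∀ Q : X, IsTopologicallyGeneratedBy o (T.RQ Q) (d * r)) (n : ℕ) :
    ∃ (ρ : MvPowerSeries (Fin (d * r)) (ResidueField o) →+* Matrix (Fin T.rank) (Fin T.rank)
        (MvPowerSeries (Fin (d * r)) (ResidueField o) ⧸
          orderIdeal (Fin (d * r)) (ResidueField o) (n + 1)))
      (f : Fin (d * r) → MvPowerSeries (Fin (d * r)) o)
      (π : MvPowerSeries (Fin (d * r)) o →ₐ[o] R) (L : M ≃ₗ[o] (Fin T.rank → o)),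
      (∀ c, ρ (C c) = Matrix.scalar (Fin T.rank) (Ideal.Quotient.mk _ (C c))) ∧
      (∀ i, constantCoeff (map (residue o) (f i)) = 0) ∧
      (∀ i, ρ (map (residue o) (f i)) =
        Matrix.scalar (Fin T.rank) (Ideal.Quotient.mk _ (MvPowerSeries.X i))) ∧
      Function.Surjective π ∧ (∀ i, π (f i) = 0) ∧
      ∀ x m i, residue o (L (π x • m) i) =
        ((quotientConstantCoeff (d * r) (ResidueField o) n).mapMatrix
          (ρ (map (residue o) x))).mulVec (fun j => residue o (L m j)) i := by
  -- An infinite set contains some Q ≠ ∅, to which the cardinality hypothesis applies; the exponent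
  -- n + 1 is never zero.
  obtain ⟨Q, ⟨hQX, hq⟩, hQ⟩ := ((h_infinite (n + 1)).sdiff (Set.finite_singleton ∅)).nonempty
  obtain ⟨P, rfl⟩ : ∃ P : X, P.1 = Q := ⟨⟨Q, hQX⟩, rfl⟩
  obtain ⟨θ, δ, hδ⟩ := exists_deltaSet_hom (h_card P.1 hQX hQ) (T.isSplitAt P.1 hQX)
    n.succ_ne_zero hq
  have := (T.isCompleteNoetherianLocalAlgebra P).isLocalHom
  have := T.free P
  have := T.finite P
  obtain ⟨π, hπ⟩ := (h_gen P).exists_surjective (T.isCompleteNoetherianLocalAlgebra P)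
  exact exists_matrix_level DeltaSet.exists_pow_eq_one θ hδ π hπ
    (Module.finBasisOfFinrankEq _ _ (T.finrank_eq P)) (T.toR P) (T.toR_surjective P) (T.factors P)

theorem TaylorWilesSystem.completeIntersection_and_free [Finite (ResidueField o)]
    (T : TaylorWilesSystem F A d ℓ o X R M)
    (h_infinite : ∀ n : ℕ, {Q ∈ X | ∀ v ∈ Q, v.q ≡ 1 [MOD ℓ ^ n]}.Infinite)
    {r : ℕ} (h_card : ∀ Q ∈ X, Q ≠ ∅ → Q.card = r)
    (h_gen : ∀ Q : X, IsTopologicallyGeneratedBy o (T.RQ Q) (d * r)) :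
    IsRelativeCompleteIntersectionDimZero o R ∧ Module.Free R M ∧
      Function.Injective (Algebra.lsmul o o M : R →ₐ[o] Module.End o M) := by
  choose ρ f π L hρC hf hρX hπ hπf hρ using T.exists_level h_infinite h_card h_gen
  obtain ⟨n, g, hg, hgf, s, hs, w, hsurj, hinj⟩ := exists_free_residual_of_matrix_system
    T.one_le_rank ρ hρC (fun n i => map (residue o) (f n i)) hf hρX
  -- Lifting the coefficients of g i as a combination of the reduced f n j gives a combination of
  -- the f n j themselves, which vanish in R.
  have hlift (i : Fin (d * r)) : ∃ G, π n G = 0 ∧ map (residue o) G = g i := by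
    obtain ⟨u, hu⟩ := (Ideal.mem_span_range_iff_exists_fun).mp (hgf i)
    choose U hU using fun j => map_surjective' residue_surjective (u j)
    refine ⟨∑ j, U j * f n j, ?_, ?_⟩
    · simp [hπf]
    · simp [hU, hu]
  choose G hπG hG using hlift
  obtain rfl : (fun i => map (residue o) (G i)) = g := funext hG
  have hw (j : Fin s) : ∃ m : M, (fun i => residue o (L n m i)) = w j := by
    choose v hv using fun i => residue_surjective (w j i)
    exact ⟨(L n).symm v, by simp [hv]⟩
  choose W hW using hw
  have hsum (a : Fin s → MvPowerSeries (Fin (d * r)) o) :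
      (fun i => residue o (L n (∑ j, π n (a j) • W j) i)) =
        ∑ j, ((quotientConstantCoeff (d * r) (ResidueField o) n).mapMatrix
          (ρ n (map (residue o) (a j)))).mulVec (w j) := by
    ext i
    rw [map_sum, Finset.sum_apply, Finset.sum_apply, map_sum]
    exact Finset.sum_congr rfl fun j _ => by rw [hρ, hW]
  have : Module.Free o M := .of_equiv (L n).symm
  have : Module.Finite o M := .equiv (L n).symm
  refine completeIntersection_and_free_of_residual (π n) (hπ n) G hπG hg hs W (fun y => ?_)
    fun a ha => hinj _ ?_
  · obtain ⟨a, ha⟩ := hsurj fun i => residue o (L n y i)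
    choose B hB using fun j => map_surjective' residue_surjective (a j)
    refine ⟨B, (mem_maximalIdeal_smul_top_iff (L n) _).mpr fun i => ?_⟩
    have h := congr_fun (hsum B) i
    simp only [hB, ha] at h
    rw [map_sub, Pi.sub_apply, map_sub, h, sub_self]
  · rw [← hsum]
    exact funext ((mem_maximalIdeal_smul_top_iff (L n) _).mp ha)

end Patching

end

theorem mainTheorem5
    {F : Type*} [Field F] (hF : IsGlobalField F)
    {A : Type*} [CommRing A] [HopfAlgebra F A] (d : ℕ) (hA : IsTorus F A d)
    (ℓ : ℕ) [Fact ℓ.Prime]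
    {o : Type*} [CommRing o] [IsLocalRing o] [IsNoetherianRing o]
    [IsAdicComplete (IsLocalRing.maximalIdeal o) o]
    [Finite (IsLocalRing.ResidueField o)] [CharP (IsLocalRing.ResidueField o) ℓ]
    (X : Set (Finset (FinPlace F)))
    {R : Type*} [CommRing R] [Algebra o R] (hR : IsCompleteNoetherianLocalAlgebra o R)
    {M : Type*} [AddCommGroup M] [Module R M] [Module o M] [IsScalarTower o R M]
    [Module.Finite R M]
    (T : TaylorWilesSystem F A d ℓ o X R M)
    (h_infinite : ∀ n : ℕ, {Q ∈ X | ∀ v ∈ Q, v.q ≡ 1 [MOD ℓ ^ n]}.Infinite)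
    (r : ℕ) (h_card : ∀ Q ∈ X, Q ≠ ∅ → Q.card = r)
    (h_gen : ∀ Q : X, IsTopologicallyGeneratedBy o (T.RQ Q) (d * r)) :
    Module.Flat o R ∧
    IsRelativeCompleteIntersectionDimZero o R ∧
    Module.Free R M ∧
    Function.Bijective (Algebra.lsmul o o M : R →ₐ[o] Module.End o M).rangeRestrict := by
  obtain ⟨hci, hfree, hinj⟩ := T.completeIntersection_and_free h_infinite h_card h_gen
  exact ⟨hci.flat, hci, hfree, fun x y h => hinj (congrArg Subtype.val h),
    AlgHom.rangeRestrict_surjective _⟩
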